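/- Let $\mathbb{F}$ be a field, $\mathbb{H}=\mathbb{F}^{2\times2}$ with standard involution $a\mapsto\bar a$ (the adjugate), and let $\mathbb{O}=\mathbb{H}\oplus\mathbb{H}w$ be the split octonion algebra over $\mathbb{F}$, with product $(a+xw)(b+yw)=ab+\bar y x+(ya+x\bar b)w$, norm $N(a+xw)=\det a-\det x$, polar form $(s|t)=N(s+t)-N(s)-N(t)$ and standard involution $\overline{a+xw}=\bar a-xw$. Let $\mathrm{Aut}\,\mathbb{O}$ be the group of all $\mathbb{F}$-algebra automorphisms of $\mathbb{O}$. Let $\mathcal{D}$ be the set of all $2$-dimensional (not necessarily unital) subalgebras $D$ of $\mathbb{O}$ such that $N|_D$ is anisotropic and has non-zero polar form. Each $D\in\mathcal D$ is a field containing $1$, and both $\mathbb{O}$ and $D^\perp$ are vector spaces over $D$ via left multiplication. Let $\mathcal{X}$ be the set of all subalgebras of the form $E+Ez$ with $E\in\mathcal{D}$, $z\in E^\perp$ and $z^2=0\ne z$, and for $D\in\mathcal{D}$ let $\mathcal{X}_D=\{X\in\mathcal{X}\mid D\subsetneq X\}$. Let $\delta\in\mathbb{F}$ be such that $m_\delta(T)=T^2-T-\delta$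 is irreducible over $\mathbb{F}$, let $D\in\mathcal{D}$, and let $u\in D$ be a root of $m_\delta$. Let $\hat g$ be the hermitian form $\hat g(x,y)=(u-\bar u)^{-1}\bigl((ux|y)-\bar u\,(x|y)\bigr)\in D$ on the $D$-vector space $D^\perp$, and let $\mathrm{SU}(D^\perp,\hat g)$ be the group of all $D$-linear bijections of $D^\perp$ that preserve $\hat g$ and have determinant $1$ over $D$. Let $\mathrm{Aut}\,\mathbb{O}_u$ be the stabilizer of $u$ in $\mathrm{Aut}\,\mathbb{O}$. (a) Restriction to $D^\perp$ is an injective group homomorphism $\mathrm{Aut}\,\mathbb{O}_u\to\mathrm{SU}(D^\perp,\hat g)$; that is, $\mathrm{Aut}\,\mathbb{O}_u$ is (via restriction) a subgroup of $\mathrm{SU}(D^\perp,\hat g)$. (b) If $\mathbb{F}$ is finite of order $q$, then this homomorphism is bijective, i.e. $\mathrm{Aut}\,\mathbb{O}_u=\mathrm{SU}(D^\perp,\hat g)$, and this group is isomorphic to $\mathrm{SU}_3(\mathbb{F}_{q^2}|\mathbb{F}_q)$, the group of all $3\times3$ matrices $A$ over a field of order $q^2$ with $A^*A=1$ and $\det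 A=1$, where $A^*$ is the transpose of $A$ with the map $s\mapsto s^q$ applied to all entries. Moreover, $Dx\mapsto D+Dx$ is a bijection from $\{Dx\mid x\in D^\perp\smallsetminus\{0\},\ N(x)=0\}$ onto $\mathcal{X}_D$, and $\mathrm{Aut}\,\mathbb{O}_u$ leaves each of these two sets invariant and acts doubly transitively on each of them. -/

import Mathlib

namespace SplitOctonion

universe u

/-- The split octonion algebra `𝕆 = ℍ ⊕ ℍw` over `F`, where `ℍ` is the algebra of `2 × 2` matrices;
the pair `(a, x)` stands for `a + xw`. -/
def Oct (F : Type u) [Field F] : Type u :=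
  Matrix (Fin 2) (Fin 2) F × Matrix (Fin 2) (Fin 2) F

section Algebra

variable {F : Type u} [Field F]

instance : AddCommGroup (Oct F) :=
  inferInstanceAs (AddCommGroup (Matrix (Fin 2) (Fin 2) F × Matrix (Fin 2) (Fin 2) F))

instance : Module F (Oct F) :=
  inferInstanceAs (Module F (Matrix (Fin 2) (Fin 2) F × Matrix (Fin 2) (Fin 2) F))

/-- The standard involution of the split quaternion algebra of `2 × 2` matrices. -/
def qconj (a : Matrix (Fin 2) (Fin 2) F) : Matrix (Fin 2) (Fin 2) F :=
  !![a 1 1, -a 0 1; -a 1 0, a 0 0]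

theorem q00 (a : Matrix (Fin 2) (Fin 2) F) : qconj a 0 0 = a 1 1 := rfl
theorem q01 (a : Matrix (Fin 2) (Fin 2) F) : qconj a 0 1 = -a 0 1 := rfl
theorem q10 (a : Matrix (Fin 2) (Fin 2) F) : qconj a 1 0 = -a 1 0 := rfl
theorem q11 (a : Matrix (Fin 2) (Fin 2) F) : qconj a 1 1 = a 0 0 := rfl

/-- `(a + xw)(b + yw) = ab + ȳx + (ya + xb̄)w`. -/
instance : Mul (Oct F) :=
  ⟨fun s t => (s.1 * t.1 + qconj t.2 * s.2, t.2 * s.1 + s.2 * qconj t.1)⟩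

instance : One (Oct F) := ⟨((1 : Matrix (Fin 2) (Fin 2) F), (0 : Matrix (Fin 2) (Fin 2) F))⟩

/-- The standard involution of `𝕆`. -/
def conj (s : Oct F) : Oct F := (qconj s.1, -s.2)

/-- The norm of `𝕆`. -/
def N (s : Oct F) : F := s.1.det - s.2.det

/-- The trace of `𝕆`. -/
def tr (s : Oct F) : F := s.1.trace

/-- The polar form `(x|y) = N(x + y) - N(x) - N(y)` of the norm. -/
def pol (x y : Oct F) : F := QuadraticMap.polar N x y

theorem oct_ext {s t : Oct F} (h1 : ∀ i j, s.1 i j = t.1 i j) (h2 : ∀ i j, s.2 i j = t.2 i j) :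
    s = t := Prod.ext (Matrix.ext h1) (Matrix.ext h2)

theorem add_fst (s t : Oct F) : (s + t).1 = s.1 + t.1 := rfl
theorem add_snd (s t : Oct F) : (s + t).2 = s.2 + t.2 := rfl
theorem sub_fst (s t : Oct F) : (s - t).1 = s.1 - t.1 := rfl
theorem sub_snd (s t : Oct F) : (s - t).2 = s.2 - t.2 := rfl
theorem smul_fst (r : F) (t : Oct F) : (r • t).1 = r • t.1 := rfl
theorem smul_snd (r : F) (t : Oct F) : (r • t).2 = r • t.2 := rfl
theorem zero_fst : (0 : Oct F).1 = 0 := rfl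
theorem zero_snd : (0 : Oct F).2 = 0 := rfl
theorem one_fst : (1 : Oct F).1 = 1 := rfl
theorem one_snd : (1 : Oct F).2 = 0 := rfl
theorem mul_fst (s t : Oct F) : (s * t).1 = s.1 * t.1 + qconj t.2 * s.2 := rfl
theorem mul_snd (s t : Oct F) : (s * t).2 = t.2 * s.1 + s.2 * qconj t.1 := rfl
theorem conj_fst (s : Oct F) : (conj s).1 = qconj s.1 := rfl
theorem conj_snd (s : Oct F) : (conj s).2 = -s.2 := rfl

instance : NonUnitalNonAssocRing (Oct F) :=
  { (inferInstance : AddCommGroup (Oct F)), (inferInstance : Mul (Oct F)) with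
    left_distrib := by
      intro a b c
      apply oct_ext <;> intro i j <;> fin_cases i <;> fin_cases j <;>
        simp [mul_fst, mul_snd, add_fst, add_snd, q00, q01, q10, q11, Matrix.mul_apply, Fin.sum_univ_two] <;>
        ring
    right_distrib := by
      intro a b c
      apply oct_ext <;> intro i j <;> fin_cases i <;> fin_cases j <;>
        simp [mul_fst, mul_snd, add_fst, add_snd, q00, q01, q10, q11, Matrix.mul_apply, Fin.sum_univ_two] <;>
        ring
    zero_mul := by
      intro a
      apply oct_ext <;> intro i j <;> fin_cases i <;> fin_cases j <;>
        simp [mul_fst, mul_snd, zero_fst, zero_snd]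
    mul_zero := by
      intro a
      apply oct_ext <;> intro i j <;> fin_cases i <;> fin_cases j <;>
        simp [mul_fst, mul_snd, zero_fst, zero_snd, q00, q01, q10, q11, Matrix.mul_apply, Fin.sum_univ_two] }

instance : IsScalarTower F (Oct F) (Oct F) where
  smul_assoc r a b := by
    change (r • a) * b = r • (a * b)
    apply oct_ext <;> intro i j <;> fin_cases i <;> fin_cases j <;>
      simp [mul_fst, mul_snd, smul_fst, smul_snd, q00, q01, q10, q11, Matrix.mul_apply, Fin.sum_univ_two] <;>
      ring

instance : SMulCommClass F (Oct F) (Oct F) where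
  smul_comm r a b := by
    change r • (a * b) = a * (r • b)
    apply oct_ext <;> intro i j <;> fin_cases i <;> fin_cases j <;>
      simp [mul_fst, mul_snd, smul_fst, smul_snd, q00, q01, q10, q11, Matrix.mul_apply, Fin.sum_univ_two] <;>
      ring

protected theorem one_mul (a : Oct F) : 1 * a = a := by
  apply oct_ext <;> intro i j <;> fin_cases i <;> fin_cases j <;>
    simp [mul_fst, mul_snd, one_fst, one_snd]

protected theorem mul_one (a : Oct F) : a * 1 = a := by
  apply oct_ext <;> intro i j <;> fin_cases i <;> fin_cases j <;>
    simp [mul_fst, mul_snd, one_fst, one_snd, q00, q01, q10, q11, Matrix.mul_apply, Fin.sum_univ_two]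

theorem one_ne_zero' : (1 : Oct F) ≠ 0 := by
  intro h
  have h1 : (1 : Matrix (Fin 2) (Fin 2) F) 0 0 = (0 : Matrix (Fin 2) (Fin 2) F) 0 0 :=
    congrFun (congrFun (congrArg Prod.fst h) 0) 0
  simp at h1

theorem conj_eq (a : Oct F) : conj a = tr a • (1 : Oct F) - a := by
  apply oct_ext <;> intro i j <;> fin_cases i <;> fin_cases j <;>
    simp [conj_fst, conj_snd, sub_fst, sub_snd, smul_fst, smul_snd, one_fst, one_snd, q00, q01, q10, q11, tr,
      Matrix.trace_fin_two]

theorem mul_self_eq (a : Oct F) : a * a = tr a • a - N a • (1 : Oct F) := by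
  apply oct_ext <;> intro i j <;> fin_cases i <;> fin_cases j <;>
    simp [mul_fst, mul_snd, sub_fst, sub_snd, smul_fst, smul_snd, one_fst, one_snd, q00, q01, q10, q11, tr, N,
      Matrix.trace_fin_two, Matrix.det_fin_two, Matrix.mul_apply, Fin.sum_univ_two] <;> ring

theorem mul_conj (a : Oct F) : a * conj a = N a • (1 : Oct F) := by
  apply oct_ext <;> intro i j <;> fin_cases i <;> fin_cases j <;>
    simp [mul_fst, mul_snd, conj_fst, conj_snd, smul_fst, smul_snd, one_fst, one_snd, q00, q01, q10, q11, N,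
      Matrix.det_fin_two, Matrix.mul_apply, Fin.sum_univ_two] <;> ring

theorem left_alt (a b : Oct F) : a * (a * b) = (a * a) * b := by
  apply oct_ext <;> intro i j <;> fin_cases i <;> fin_cases j <;>
    simp [mul_fst, mul_snd, q00, q01, q10, q11, Matrix.mul_apply, Fin.sum_univ_two] <;> ring

theorem pol_eq (x y : Oct F) :
    pol x y = x.1 0 0 * y.1 1 1 + x.1 1 1 * y.1 0 0 - x.1 0 1 * y.1 1 0 - x.1 1 0 * y.1 0 1
      - (x.2 0 0 * y.2 1 1 + x.2 1 1 * y.2 0 0 - x.2 0 1 * y.2 1 0 - x.2 1 0 * y.2 0 1) := by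
  simp only [pol, QuadraticMap.polar, N, Matrix.det_fin_two, add_fst, add_snd, Matrix.add_apply]
  ring

theorem pol_add (x y z : Oct F) : pol x (y + z) = pol x y + pol x z := by
  simp only [pol_eq, add_fst, add_snd, Matrix.add_apply]; ring

theorem pol_smul (r : F) (x y : Oct F) : pol x (r • y) = r * pol x y := by
  simp only [pol_eq, smul_fst, smul_snd, Matrix.smul_apply, smul_eq_mul]; ring

theorem pol_zero (x : Oct F) : pol x 0 = 0 := by
  simp [pol_eq, zero_fst, zero_snd]

theorem pol_mul (x y z : Oct F) : pol x (y * z) = pol (conj y * x) z := by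
  simp [pol_eq, mul_fst, mul_snd, conj_fst, conj_snd, q00, q01, q10, q11, Matrix.mul_apply, Fin.sum_univ_two]
  ring

end Algebra

/-- The group of all algebra automorphisms of `𝕆`. -/
def Aut (F : Type u) [Field F] : Subgroup (Oct F ≃ₗ[F] Oct F) where
  carrier := {α | ∀ x y, α (x * y) = α x * α y}
  one_mem' := fun _ _ => rfl
  mul_mem' {α β} hα hβ x y := by
    change α (β (x * y)) = α (β x) * α (β y)
    rw [hβ, hα]
  inv_mem' {α} hα x y := by
    change α.symm (x * y) = α.symm x * α.symm y
    apply α.injective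
    rw [hα]
    simp

/-- The stabilizer of an element `u` of `𝕆` in the automorphism group of `𝕆`. -/
def stab {F : Type u} [Field F] (u : Oct F) : Subgroup (Oct F ≃ₗ[F] Oct F) where
  carrier := {α | α ∈ Aut F ∧ α u = u}
  one_mem' := ⟨(Aut F).one_mem, rfl⟩
  mul_mem' {α β} hα hβ := ⟨(Aut F).mul_mem hα.1 hβ.1, by
    change α (β u) = u
    rw [hβ.2, hα.2]⟩
  inv_mem' {α} hα := ⟨(Aut F).inv_mem hα.1, by
    change α.symm u = u
    rw [LinearEquiv.symm_apply_eq, hα.2]⟩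

/-- The set `𝒟` of all two-dimensional (not necessarily unital) subalgebras of `𝕆` such that the
restriction of the norm is anisotropic and has non-trivial polar form. -/
def calD (F : Type u) [Field F] : Set (NonUnitalSubalgebra F (Oct F)) :=
  {D | Module.finrank F D = 2 ∧ (∀ x ∈ D, N x = 0 → x = 0) ∧ ∃ x ∈ D, ∃ y ∈ D, pol x y ≠ 0}

section Field

variable {F : Type u} [Field F]

theorem one_mem (D : calD F) : (1 : Oct F) ∈ D.1 := by
  obtain ⟨hdim, han, -⟩ := D.2
  have : Nontrivial D.1 := Module.nontrivial_of_finrank_pos (R := F) (by omega)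
  obtain ⟨⟨x, hx⟩, hne⟩ := exists_ne (0 : D.1)
  have hN : N x ≠ 0 := fun h => hne (Subtype.ext (han x hx h))
  have h1 : (1 : Oct F) = (N x)⁻¹ • (tr x • x - x * x) := by
    rw [mul_self_eq, sub_sub_cancel, smul_smul, inv_mul_cancel₀ hN, one_smul]
  rw [h1]
  exact D.1.smul_mem _ (sub_mem (D.1.smul_mem _ hx) (D.1.mul_mem hx hx))

theorem conj_mem (D : calD F) {x : Oct F} (hx : x ∈ D.1) : conj x ∈ D.1 := by
  rw [conj_eq]
  exact sub_mem (D.1.smul_mem _ (one_mem D)) hx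

theorem exists_gen (D : calD F) :
    ∃ v ∈ D.1, ∀ x ∈ D.1, ∃ a b : F, x = a • (1 : Oct F) + b • v := by
  have hdim := D.2.1
  have : Module.Finite F D.1 := Module.finite_of_finrank_pos (by omega)
  let o : D.1 := ⟨1, one_mem D⟩
  have ho : o ≠ 0 := fun h => one_ne_zero' (congrArg Subtype.val h)
  obtain ⟨v, hv⟩ := exists_linearIndependent_pair_of_one_lt_finrank (R := F) (by omega) ho
  have hs := hv.span_eq_top_of_card_eq_finrank' (by simp [hdim])
  refine ⟨v, v.2, fun x hx => ?_⟩
  have hm : (⟨x, hx⟩ : D.1) ∈ Submodule.span F (Set.range ![o, v]) := by rw [hs]; trivial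
  simp only [Matrix.range_cons, Matrix.range_empty, Set.union_empty, Set.singleton_union,
    Submodule.mem_span_pair] at hm
  obtain ⟨a, b, hab⟩ := hm
  exact ⟨a, b, (congrArg Subtype.val hab).symm⟩

/-- The elements of `D ∈ 𝒟` act on `𝕆` from the left associatively. -/
theorem smul_assoc_of_mem (D : calD F) {x y : Oct F} (hx : x ∈ D.1) (hy : y ∈ D.1) (z : Oct F) :
    (x * y) * z = x * (y * z) := by
  obtain ⟨v, -, hgen⟩ := exists_gen D
  obtain ⟨a, b, rfl⟩ := hgen x hx
  obtain ⟨c, d, rfl⟩ := hgen y hy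
  simp only [add_mul, mul_add, smul_mul_assoc, mul_smul_comm, SplitOctonion.one_mul,
    SplitOctonion.mul_one, left_alt, smul_add]

theorem mul_comm_of_mem (D : calD F) {x y : Oct F} (hx : x ∈ D.1) (hy : y ∈ D.1) :
    x * y = y * x := by
  obtain ⟨v, -, hgen⟩ := exists_gen D
  obtain ⟨a, b, rfl⟩ := hgen x hx
  obtain ⟨c, d, rfl⟩ := hgen y hy
  simp only [add_mul, mul_add, smul_mul_assoc, mul_smul_comm, SplitOctonion.one_mul,
    SplitOctonion.mul_one]
  module

instance (D : calD F) : CommRing D.1 :=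
  { (inferInstance : NonUnitalNonAssocRing D.1) with
    one := ⟨1, one_mem D⟩
    one_mul := fun x => Subtype.ext (SplitOctonion.one_mul x.1)
    mul_one := fun x => Subtype.ext (SplitOctonion.mul_one x.1)
    mul_assoc := fun x y z => Subtype.ext (smul_assoc_of_mem D x.2 y.2 z.1)
    mul_comm := fun x y => Subtype.ext (mul_comm_of_mem D x.2 y.2) }

/-- The standard involution on `D ∈ 𝒟`. -/
def conjD {D : calD F} (x : D.1) : D.1 := ⟨conj x.1, conj_mem D x.2⟩

/-- Each `D ∈ 𝒟` is a field. -/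
noncomputable instance (D : calD F) : Field D.1 :=
  { (inferInstance : CommRing D.1) with
    inv := fun x => (N x.1)⁻¹ • conjD x
    exists_pair_ne := ⟨0, 1, fun h => one_ne_zero' (congrArg Subtype.val h).symm⟩
    mul_inv_cancel := fun x hx => by
      have hN : N x.1 ≠ 0 := fun h => hx (Subtype.ext (D.2.2.1 x.1 x.2 h))
      apply Subtype.ext
      change x.1 * ((N x.1)⁻¹ • conj x.1) = 1
      rw [mul_smul_comm, mul_conj, smul_smul, inv_mul_cancel₀ hN, one_smul]
    inv_zero := by
      apply Subtype.ext
      change (N (0 : Oct F))⁻¹ • conj (0 : Oct F) = 0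
      have h : N (0 : Oct F) = 0 := by simp [N, zero_fst, zero_snd]
      rw [h, inv_zero, zero_smul]
    nnqsmul := _
    nnqsmul_def := fun _ _ => rfl
    qsmul := _
    qsmul_def := fun _ _ => rfl }

/-- The orthogonal space `D^⊥`. -/
def perp (D : calD F) : Submodule F (Oct F) where
  carrier := {x | ∀ d ∈ D.1, pol d x = 0}
  add_mem' {x y} hx hy d hd := by rw [pol_add, hx d hd, hy d hd, add_zero]
  zero_mem' d _ := pol_zero d
  smul_mem' r x hx d hd := by rw [pol_smul, hx d hd, mul_zero]

theorem mul_mem_perp (D : calD F) {c x : Oct F} (hc : c ∈ D.1) (hx : x ∈ perp D) :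
    c * x ∈ perp D := fun d hd => by
  rw [pol_mul]
  exact hx _ (D.1.mul_mem (conj_mem D hc) hd)

/-- `D^⊥` is a vector space over `D`, via the multiplication of `𝕆`. -/
instance (D : calD F) : Module D.1 (perp D) where
  smul c x := ⟨c.1 * x.1, mul_mem_perp D c.2 x.2⟩
  one_smul x := Subtype.ext (SplitOctonion.one_mul x.1)
  mul_smul c d x := Subtype.ext (smul_assoc_of_mem D c.2 d.2 x.1)
  smul_zero c := Subtype.ext (mul_zero c.1)
  smul_add c x y := Subtype.ext (mul_add c.1 x.1 y.1)
  add_smul c d x := Subtype.ext (add_mul c.1 d.1 x.1)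
  zero_smul x := Subtype.ext (zero_mul x.1)

/-- The hermitian form `ĝ(x, y) = (u - ū)⁻¹ ((ux|y) - ū (x|y))` on `D^⊥`. -/
noncomputable def gHat {D : calD F} (u : D.1) (x y : perp D) : D.1 :=
  (u - conjD u)⁻¹ *
    (pol (u.1 * x.1) y.1 • (1 : D.1) - pol x.1 y.1 • conjD u)

/-- The special unitary group `SU(D^⊥, ĝ)`: all `D`-linear isometries of `ĝ` with determinant `1`
over `D`. -/
noncomputable def SU {D : calD F} (u : D.1) : Subgroup (perp D ≃ₗ[D.1] perp D) where
  carrier := {φ | (∀ x y, gHat u (φ x) (φ y) = gHat u x y) ∧ LinearEquiv.det φ = 1}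
  one_mem' := ⟨fun _ _ => rfl, map_one _⟩
  mul_mem' {φ ψ} hφ hψ := by
    refine ⟨fun x y => ?_, by rw [map_mul, hφ.2, hψ.2, mul_one]⟩
    change gHat u (φ (ψ x)) (φ (ψ y)) = _
    rw [hφ.1, hψ.1]
  inv_mem' {φ} hφ := by
    refine ⟨fun x y => ?_, by rw [map_inv, hφ.2, inv_one]⟩
    change gHat u (φ.symm x) (φ.symm y) = _
    rw [← hφ.1, φ.apply_symm_apply, φ.apply_symm_apply]

/-- The subspace `Dz = {dz | d ∈ D}`. -/
def leftMultiples (D : calD F) (z : Oct F) : Submodule F (Oct F) :=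
  D.1.toSubmodule.map (LinearMap.mulRight F z)

/-- The set `𝒳` of all subalgebras of the form `E + Ez` with `E ∈ 𝒟` and `z ∈ E^⊥`,
`z² = 0 ≠ z`. -/
def calX (F : Type u) [Field F] : Set (NonUnitalSubalgebra F (Oct F)) :=
  {X | ∃ E : calD F, ∃ z ∈ perp E, z * z = 0 ∧ z ≠ 0 ∧
    X.toSubmodule = E.1.toSubmodule ⊔ leftMultiples E z}

/-- The set `𝒳_D` of all members of `𝒳` that contain `D` properly
(each considered as a subspace of `𝕆`). -/
def calXOver (D : calD F) : Set (Submodule F (Oct F)) :=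
  {V | ∃ X ∈ calX F, D.1 < X ∧ V = X.toSubmodule}

/-- The set of all subspaces `Dx` with `x ∈ D^⊥`, `x ≠ 0` and `N(x) = 0`. -/
def isotropicLines (D : calD F) : Set (Submodule F (Oct F)) :=
  {L | ∃ x ∈ perp D, x ≠ 0 ∧ N x = 0 ∧ L = leftMultiples D x}

/-- The group `G` of linear bijections leaves the set `S` of subspaces invariant, and any pair of
distinct members of `S` can be mapped to any other such pair. -/
def ActsDoublyTransitively (G : Subgroup (Oct F ≃ₗ[F] Oct F)) (S : Set (Submodule F (Oct F))) :
    Prop :=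
  (∀ α ∈ G, ∀ V ∈ S, V.map (α : Oct F →ₗ[F] Oct F) ∈ S) ∧
  ∀ V₁ ∈ S, ∀ V₂ ∈ S, ∀ W₁ ∈ S, ∀ W₂ ∈ S, V₁ ≠ V₂ → W₁ ≠ W₂ →
    ∃ α ∈ G, V₁.map (α : Oct F →ₗ[F] Oct F) = W₁ ∧ V₂.map (α : Oct F →ₗ[F] Oct F) = W₂

end Field

end SplitOctonion

/-! Over `D` the space `D^⊥` has dimension 3, and the whole algebra can be written in terms of it.
For `x`, `y` in `D^⊥` the product splits as `xy = -ĝ(x,y) + x × y` with `x × y` in `D^⊥`. Moreover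
`ĝ(z, x × y)` is the `D`-valued lift `triple u x y z` of the trilinear form `(xy|z)`. This lift is
alternating and non-zero, hence a determinant form on `D^⊥` (`gHat_cross`, `tripleMap`).

An automorphism fixing `u` fixes `D` pointwise and preserves the norm (`Aut_N`). It therefore
preserves both `ĝ` and the determinant form, so its restriction lies in SU. Conversely, an element
of SU preserves `ĝ` and the determinant form, hence the cross product, because `ĝ` is nondegenerate
(`map_cross`). Its extension by the identity on `D` is then multiplicative (`extend_mem`).

The geometry rests on the Gram identity `N(x × y) = N(x)N(y) - N(ĝ(x,y))` (`N_cross`). If this value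
is non-zero, then `x`, `y`, `x × y` is a basis, and prescribing the images of `x` and `y` with the
same Gram matrix gives an element of SU (`exists_mem_SU`). In particular SU is transitive on pairs
`x`, `y` of isotropic vectors with `ĝ(x,y) = 1`. Distinct isotropic lines always contain such a
pair, because the Witt index is at most one (`exists_smul_eq_of_isotropic`); this gives double
transitivity. The lines correspond to `𝒳_D` by a dimension count, since the radical vector `z` of `E
+ Ez` is orthogonal to every `D` inside it (`sup_surjOn`).

Over a finite field the norm of `D` is onto, so vectors can be rescaled to an orthonormal basis, and
the involution of `D` is the Frobenius map. Matrices with respect to that basis identify SU with the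
standard group. -/

namespace SplitOctonion

universe u v

/-! ### Composition algebra identities and nondegeneracy of the norm form -/

section Identities

variable {F : Type u} [Field F]

theorem pol_comm (x y : Oct F) : pol x y = pol y x := by
  simp only [pol_eq]; ring

theorem pol_add_left (x y z : Oct F) : pol (x + y) z = pol x z + pol y z := by
  rw [pol_comm, pol_add, pol_comm z x, pol_comm z y]

theorem pol_smul_left (r : F) (x y : Oct F) : pol (r • x) y = r * pol x y := by
  rw [pol_comm, pol_smul, pol_comm]

theorem pol_one (x : Oct F) : pol 1 x = tr x := by
  simp [pol_eq, one_fst, one_snd, tr, Matrix.trace_fin_two, add_comm]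

theorem pol_self (x : Oct F) : pol x x = 2 * N x := by
  simp only [pol_eq, N, Matrix.det_fin_two]; ring

theorem N_add (x y : Oct F) : N (x + y) = N x + N y + pol x y := by
  simp only [pol, QuadraticMap.polar]; ring

theorem N_smul (r : F) (x : Oct F) : N (r • x) = r ^ 2 * N x := by
  simp only [N, Matrix.det_fin_two, smul_fst, smul_snd, Matrix.smul_apply, smul_eq_mul]; ring

theorem N_zero : N (0 : Oct F) = 0 := by simp [N, zero_fst, zero_snd]

theorem N_one : N (1 : Oct F) = 1 := by simp [N, one_fst, one_snd]

theorem tr_one : tr (1 : Oct F) = 2 := by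
  simp [tr, one_fst]

theorem tr_add (x y : Oct F) : tr (x + y) = tr x + tr y := by
  simp [tr, add_fst]

theorem tr_smul (r : F) (x : Oct F) : tr (r • x) = r * tr x := by
  simp [tr, smul_fst]

theorem N_mul (x y : Oct F) : N (x * y) = N x * N y := by
  simp only [N, Matrix.det_fin_two, mul_fst, mul_snd, q00, q01, q10, q11, Matrix.mul_apply,
    Matrix.add_apply, Fin.sum_univ_two]
  ring

theorem pol_mul_left (x y z : Oct F) : pol (x * y) z = pol y (conj x * z) := by
  rw [pol_comm, pol_mul, pol_comm]

theorem pol_mul_right (x y z : Oct F) : pol (x * y) z = pol x (z * conj y) := by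
  simp only [pol_eq, mul_fst, mul_snd, conj_fst, conj_snd, q00, q01, q10, q11, Matrix.mul_apply,
    Matrix.add_apply, Matrix.neg_apply, Fin.sum_univ_two]
  ring

theorem pol_mul_mul_right (x y z : Oct F) : pol (x * y) (z * y) = N y * pol x z := by
  simp only [pol, QuadraticMap.polar, ← add_mul, N_mul]; ring

theorem conj_conj (x : Oct F) : conj (conj x) = x := by
  apply oct_ext <;> intro i j <;> fin_cases i <;> fin_cases j <;>
    simp [conj_fst, conj_snd, q00, q01, q10, q11]

theorem conj_add (x y : Oct F) : conj (x + y) = conj x + conj y := by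
  simp only [conj_eq, tr_add, add_smul]; abel

theorem conj_smul (r : F) (x : Oct F) : conj (r • x) = r • conj x := by
  simp only [conj_eq, tr_smul, smul_sub, mul_smul]

theorem conj_one : conj (1 : Oct F) = 1 := by
  rw [conj_eq, tr_one, two_smul, add_sub_cancel_right]

theorem conj_mul (x y : Oct F) : conj (x * y) = conj y * conj x := by
  apply oct_ext <;> intro i j <;> fin_cases i <;> fin_cases j <;>
    simp [mul_fst, mul_snd, conj_fst, conj_snd, q00, q01, q10, q11, Matrix.mul_apply,
      Fin.sum_univ_two] <;> ring

theorem mul_conj_add_mul_conj (x y : Oct F) :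
    x * conj y + y * conj x = pol x y • (1 : Oct F) := by
  have h := mul_conj (x + y)
  rw [N_add, conj_add, add_mul, mul_add, mul_add, mul_conj, mul_conj, add_smul, add_smul] at h
  rw [← sub_eq_zero] at h ⊢
  rw [← h]; abel

theorem conj_mul_mul (x y : Oct F) : conj x * (x * y) = N x • y := by
  have h : tr x • x - x * x = N x • (1 : Oct F) := by rw [mul_self_eq]; abel
  rw [conj_eq, sub_mul, smul_mul_assoc, SplitOctonion.one_mul, left_alt, ← smul_mul_assoc,
    ← sub_mul, h, smul_mul_assoc, SplitOctonion.one_mul]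

/-- Linearization of `conj_mul_mul` in `x`; it replaces associativity in the later computations. -/
theorem conj_mul_mul_add (x y z : Oct F) :
    conj x * (y * z) + conj y * (x * z) = pol x y • z := by
  have h := conj_mul_mul (x + y) z
  rw [N_add, conj_add, add_mul, add_mul, mul_add, mul_add, conj_mul_mul, conj_mul_mul, add_smul,
    add_smul] at h
  rw [← sub_eq_zero] at h ⊢
  rw [← h]; abel

/-- The polar form of the norm, as a bilinear form. -/
def polForm (F : Type u) [Field F] : LinearMap.BilinForm F (Oct F) :=
  LinearMap.mk₂ F pol pol_add_left pol_smul_left pol_add pol_smul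

theorem eq_zero_of_pol {x : Oct F} (h : ∀ y, pol x y = 0) : x = 0 := by
  have h' (a b : Matrix (Fin 2) (Fin 2) F) := (pol_eq x (a, b)).symm.trans (h (a, b))
  apply oct_ext <;> intro i j
  · have := h' (Matrix.single (1 - i) (1 - j) 1) 0
    fin_cases i <;> fin_cases j <;> simpa [zero_fst] using this
  · have := h' 0 (Matrix.single (1 - i) (1 - j) 1)
    fin_cases i <;> fin_cases j <;> simpa [zero_snd] using this

theorem polForm_nondegenerate : (polForm F).Nondegenerate :=
  ⟨fun _ h => eq_zero_of_pol h, fun _ h => eq_zero_of_pol fun y => (pol_comm _ _).trans (h y)⟩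

instance : Module.Finite F (Oct F) :=
  inferInstanceAs (Module.Finite F (Matrix (Fin 2) (Fin 2) F × Matrix (Fin 2) (Fin 2) F))

theorem finrank_oct : Module.finrank F (Oct F) = 8 := by
  change Module.finrank F (Matrix (Fin 2) (Fin 2) F × Matrix (Fin 2) (Fin 2) F) = 8
  simp [Module.finrank_prod, Module.finrank_matrix]

end Identities

/-! ### The field `D`, its generator `u`, and the `D`-space `D^⊥` -/

section Subfield

variable {F : Type u} [Field F] {D : calD F}

theorem coe_mul (c d : D.1) : ((c * d : D.1) : Oct F) = (c : Oct F) * (d : Oct F) := rfl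

theorem coe_one : ((1 : D.1) : Oct F) = 1 := rfl

theorem coe_conjD (c : D.1) : ((conjD c : D.1) : Oct F) = conj (c : Oct F) := rfl

theorem coe_smul_perp (c : D.1) (x : perp D) : ((c • x : perp D) : Oct F) = (c : Oct F) * x := rfl

variable (D) in
/-- The inclusion of the ground field into `D ∈ 𝒟`. -/
noncomputable def ofF : F →+* D.1 where
  toFun a := a • (1 : D.1)
  map_one' := one_smul _ _
  map_mul' a b := Subtype.ext <| by
    change (a * b) • (1 : Oct F) = (a • (1 : Oct F)) * (b • (1 : Oct F))
    rw [smul_mul_assoc, SplitOctonion.one_mul, smul_smul]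
  map_zero' := zero_smul _ _
  map_add' a b := add_smul _ _ _

theorem coe_ofF (a : F) : ((ofF D a : D.1) : Oct F) = a • (1 : Oct F) := rfl

theorem smul_eq_ofF_mul (a : F) (c : D.1) : a • c = ofF D a * c := Subtype.ext <| by
  change a • (c : Oct F) = (a • (1 : Oct F)) * (c : Oct F)
  rw [smul_mul_assoc, SplitOctonion.one_mul]

theorem ofF_smul (a : F) (x : perp D) : ofF D a • x = a • x := Subtype.ext <| by
  change (a • (1 : Oct F)) * (x : Oct F) = a • (x : Oct F)
  rw [smul_mul_assoc, SplitOctonion.one_mul]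

theorem conjD_mul (c d : D.1) : conjD (c * d) = conjD c * conjD d := Subtype.ext <| by
  rw [coe_conjD, coe_mul, conj_mul, mul_comm_of_mem D (conj_mem D d.2) (conj_mem D c.2)]; rfl

theorem conjD_add (c d : D.1) : conjD (c + d) = conjD c + conjD d := Subtype.ext (conj_add _ _)

theorem conjD_ofF (a : F) : conjD (ofF D a) = ofF D a := Subtype.ext <| by
  rw [coe_conjD, coe_ofF, conj_smul, conj_one]

variable (D) in
/-- The standard involution on `D ∈ 𝒟`, as a ring homomorphism. -/
noncomputable def conjHom : D.1 →+* D.1 where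
  toFun := conjD
  map_one' := Subtype.ext conj_one
  map_mul' := conjD_mul
  map_zero' := by simpa using conjD_ofF (D := D) 0
  map_add' := conjD_add

theorem conjHom_apply (c : D.1) : conjHom D c = conjD c := rfl

theorem mul_conjD (c : D.1) : c * conjD c = ofF D (N (c : Oct F)) := Subtype.ext (mul_conj _)

theorem add_conjD (c : D.1) : c + conjD c = ofF D (tr (c : Oct F)) := Subtype.ext <| by
  change (c : Oct F) + conj (c : Oct F) = _
  rw [conj_eq, coe_ofF]; abel

theorem ofF_injective : Function.Injective (ofF D) := (ofF D).injective

theorem N_coe_ne_zero {c : D.1} (hc : c ≠ 0) : N (c : Oct F) ≠ 0 :=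
  fun h => hc (Subtype.ext (D.2.2.1 c c.2 h))

/-- An element of trace `1` which generates `D` over the ground field. -/
structure IsGenerator (u : D.1) : Prop where
  tr_eq : tr (u : Oct F) = 1
  ne_ofF : ∀ a : F, u ≠ ofF D a

theorem isGenerator_of_root {δ : F}
    (hδ : Irreducible (Polynomial.X ^ 2 - Polynomial.X - Polynomial.C δ : Polynomial F))
    {u : D.1} (hu : u ^ 2 - u - δ • (1 : D.1) = 0) : IsGenerator u := by
  have hne : ∀ a : F, u ≠ ofF D a := by
    rintro a rfl
    have h0 : a ^ 2 - a - δ = 0 := by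
      apply ofF_injective (D := D)
      rw [map_sub, map_sub, map_pow, map_zero]
      exact hu
    have hroot : (Polynomial.X ^ 2 - Polynomial.X - Polynomial.C δ : Polynomial F).IsRoot a := by
      simpa using h0
    have hdeg := Polynomial.degree_eq_one_of_irreducible_of_root hδ hroot
    have : (Polynomial.X ^ 2 - Polynomial.X - Polynomial.C δ : Polynomial F).degree = 2 := by
      compute_degree!
    rw [this] at hdeg
    exact absurd hdeg (by decide)
  refine ⟨?_, hne⟩
  by_contra htr
  have hu' : u * u = u + ofF D δ := by
    rw [← sub_eq_zero, ← hu, pow_two, ← sub_sub]; rfl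
  -- The difference of the two quadratic equations for `u` is linear; if the trace were not 1, it
  -- would place `u` in the ground field.
  have h2 : ofF D (tr (u : Oct F) - 1) * u = ofF D (N (u : Oct F) + δ) := by
    have h3 : u * u = ofF D (tr (u : Oct F)) * u - ofF D (N (u : Oct F)) := by
      rw [← add_conjD, ← mul_conjD]; ring
    rw [map_sub, map_add, map_one]
    linear_combination hu' - h3
  refine hne ((tr (u : Oct F) - 1)⁻¹ * (N (u : Oct F) + δ)) ?_
  rw [map_mul, ← h2, ← mul_assoc, ← map_mul, inv_mul_cancel₀ (sub_ne_zero.2 htr), map_one,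
    one_mul]

namespace IsGenerator

variable {u : D.1} (hu : IsGenerator u)
include hu

theorem conjD_eq : conjD u = 1 - u := by
  have := add_conjD u
  rw [hu.tr_eq, map_one] at this
  rw [← this]; ring

theorem mul_self : u * u = u - ofF D (N (u : Oct F)) := by
  rw [← mul_conjD, hu.conjD_eq]; ring

theorem coords_eq_zero {a b : F} (h : ofF D a + ofF D b * u = 0) : a = 0 ∧ b = 0 := by
  have hb : b = 0 := by
    by_contra hb
    refine hu.ne_ofF (-(b⁻¹ * a)) ?_
    rw [map_neg, map_mul, eq_neg_of_add_eq_zero_left h, mul_neg, neg_neg, ← mul_assoc, ← map_mul,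
      inv_mul_cancel₀ hb, map_one, one_mul]
  subst hb
  refine ⟨ofF_injective (D := D) ?_, rfl⟩
  rw [map_zero, zero_mul, add_zero] at h
  rw [h, map_zero]

theorem sub_conjD_ne_zero : u - conjD u ≠ 0 := by
  rw [hu.conjD_eq]
  intro h
  -- Here `u - ū = 2u - 1`; the coordinate `-1` is non-zero in every characteristic, including 2.
  have := hu.coords_eq_zero (a := -1) (b := 2) (by
    rw [map_neg, map_one, map_ofNat]; linear_combination h)
  simp at this

theorem exists_coords (c : D.1) : ∃ a b : F, c = ofF D a + ofF D b * u := by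
  have hli : LinearIndependent F ![(1 : D.1), u] := by
    rw [LinearIndependent.pair_iff]
    intro a b h
    exact hu.coords_eq_zero (by rw [← h, smul_eq_ofF_mul, smul_eq_ofF_mul, mul_one])
  have hdim : Module.finrank F D.1 = 2 := D.2.1
  have : Module.Finite F D.1 := Module.finite_of_finrank_pos (by omega)
  have hs := hli.span_eq_top_of_card_eq_finrank' (by simp [hdim])
  have hm : c ∈ Submodule.span F (Set.range ![(1 : D.1), u]) := by rw [hs]; trivial
  simp only [Matrix.range_cons, Matrix.range_empty, Set.union_empty, Set.singleton_union,
    Submodule.mem_span_pair] at hm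
  obtain ⟨a, b, rfl⟩ := hm
  exact ⟨a, b, by rw [smul_eq_ofF_mul, smul_eq_ofF_mul, mul_one]⟩

end IsGenerator

instance : IsScalarTower F D.1 (perp D) where
  smul_assoc a c x := by rw [smul_eq_ofF_mul, mul_smul, ofF_smul]

theorem perp_one_pol (x : perp D) : pol 1 (x : Oct F) = 0 := x.2 1 (one_mem D)

theorem tr_perp (x : perp D) : tr (x : Oct F) = 0 := by rw [← pol_one, perp_one_pol]

theorem conj_perp (x : perp D) : conj (x : Oct F) = -x := by
  rw [conj_eq, tr_perp, zero_smul, zero_sub]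

/-- Elements of `D^⊥` commute with elements of `D` up to conjugation. -/
theorem perp_mul (x : perp D) (c : D.1) : (x : Oct F) * c = conj (c : Oct F) * x := by
  have h := mul_conj_add_mul_conj (x : Oct F) (conj (c : Oct F))
  rw [conj_conj, conj_perp, pol_comm, x.2 _ (conj_mem D c.2), zero_smul, mul_neg] at h
  exact eq_of_sub_eq_zero ((sub_eq_add_neg _ _).trans h)

theorem perp_mul_mul (x : perp D) (c : D.1) (z : Oct F) :
    (x : Oct F) * (c * z) = conj (c : Oct F) * (x * z) := by
  have h := conj_mul_mul_add (x : Oct F) c z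
  rw [conj_perp, pol_comm, x.2 _ c.2, zero_smul, neg_mul] at h
  exact (neg_add_eq_zero.1 h)

theorem perp_mul_self (x : perp D) : (x : Oct F) * x = -(N (x : Oct F) • (1 : Oct F)) := by
  rw [mul_self_eq, tr_perp, zero_smul, zero_sub]

theorem perp_mul_add_mul (x y : perp D) :
    (x : Oct F) * y + (y : Oct F) * x = -(pol (x : Oct F) y • (1 : Oct F)) := by
  rw [← mul_conj_add_mul_conj, conj_perp, conj_perp, mul_neg, mul_neg]; abel

variable (D) in
theorem finrank_perp_base : Module.finrank F (perp D) = 6 := by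
  have h := LinearMap.BilinForm.finrank_orthogonal (B := polForm F) polForm_nondegenerate
    D.1.toSubmodule
  have h2 : Module.finrank F D.1.toSubmodule = 2 := D.2.1
  rw [finrank_oct, h2] at h
  have he : (polForm F).orthogonal D.1.toSubmodule = perp D := by
    ext x; rfl
  rw [he] at h
  exact h

instance : Module.Finite F D.1 :=
  inferInstanceAs (Module.Finite F D.1.toSubmodule)

instance : Module.Finite D.1 (perp D) := Module.Finite.of_restrictScalars_finite F D.1 (perp D)

variable (D) in
theorem finrank_perp : Module.finrank D.1 (perp D) = 3 := by
  have h := Module.finrank_mul_finrank F D.1 (perp D)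
  have hdim : Module.finrank F D.1 = 2 := D.2.1
  rw [hdim, finrank_perp_base] at h
  omega

/-- The radical of the polar form on `D` is an ideal of the field `D`, and it is proper because the
polar form is non-zero. In characteristic 2 anisotropy alone would not suffice. -/
theorem pol_nondegenerate_on {x : Oct F} (hx : x ∈ D.1) (h : ∀ d ∈ D.1, pol d x = 0) : x = 0 := by
  by_contra hne
  obtain ⟨u, hu, v, hv, huv⟩ := D.2.2.2
  refine huv ?_
  have hN : N x ≠ 0 := fun h0 => hne (D.2.2.1 x hx h0)
  have hx' : (u * (v * x)) ∈ D.1 := D.1.mul_mem hu (D.1.mul_mem hv hx)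
  let c : D.1 := ⟨x, hx⟩
  have hc : c ≠ 0 := fun h0 => hne (congrArg Subtype.val h0)
  -- Every `v` in `D` is a multiple of `x`; the factor moves to the other side of the form, so
  -- `(u|v)` would vanish.
  have : v = v * (c⁻¹ : D.1).1 * x := by
    have := congrArg Subtype.val (inv_mul_cancel_right₀ hc (⟨v, hv⟩ : D.1))
    exact this.symm
  have hw : v * (c⁻¹ : D.1).1 ∈ D.1 := D.1.mul_mem hv (c⁻¹ : D.1).2
  rw [this, pol_mul]
  exact h _ (D.1.mul_mem (conj_mem D hw) hu)

theorem disjoint_perp : Disjoint D.1.toSubmodule (perp D) := by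
  rw [Submodule.disjoint_def]
  exact fun x hx hp => pol_nondegenerate_on hx hp

variable (D) in
theorem isCompl_perp : IsCompl D.1.toSubmodule (perp D) := by
  refine (Submodule.isCompl_iff_disjoint _ _ ?_).2 disjoint_perp
  have hdim : Module.finrank F D.1.toSubmodule = 2 := D.2.1
  rw [finrank_oct, hdim, finrank_perp_base]

theorem exists_add_perp (s : Oct F) : ∃ (c : D.1) (x : perp D), s = (c : Oct F) + x := by
  have h : s ∈ D.1.toSubmodule ⊔ perp D := by rw [(isCompl_perp D).sup_eq_top]; trivial
  obtain ⟨c, hc, x, hx, rfl⟩ := Submodule.mem_sup.1 h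
  exact ⟨⟨c, hc⟩, ⟨x, hx⟩, rfl⟩

theorem perp_eq_zero_of_pol {x : perp D} (h : ∀ y : perp D, pol (x : Oct F) y = 0) : x = 0 := by
  refine Subtype.ext (eq_zero_of_pol fun s => ?_)
  obtain ⟨c, y, rfl⟩ := exists_add_perp (D := D) s
  rw [pol_add, h, pol_comm, x.2 _ c.2, add_zero]

end Subfield

/-! ### The hermitian form, the determinant form and the cross product -/

section Hermitian

variable {F : Type u} [Field F] {D : calD F}

/-- The element of `D` with `u`-coordinates `a` and `b`: if `f` is a linear form on a `D`-module, then
`x ↦ coLift u (f (u x)) (f x)` is the `D`-linear form with trace `f`. -/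
noncomputable def coLift (u : D.1) (a b : F) : D.1 :=
  (u - conjD u)⁻¹ * (ofF D a - ofF D b * conjD u)

theorem coLift_add (u : D.1) (a b a' b' : F) :
    coLift u (a + a') (b + b') = coLift u a b + coLift u a' b' := by
  simp only [coLift, map_add]; ring

theorem coLift_sub (u : D.1) (a b a' b' : F) :
    coLift u (a - a') (b - b') = coLift u a b - coLift u a' b' := by
  simp only [coLift, map_sub]; ring

theorem coLift_mul (u : D.1) (r a b : F) :
    coLift u (r * a) (r * b) = ofF D r * coLift u a b := by
  simp only [coLift, map_mul]; ring

theorem coLift_zero (u : D.1) : coLift u 0 0 = 0 := by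
  simp [coLift]

theorem gHat_eq (u : D.1) (x y : perp D) :
    gHat u x y = coLift u (pol ((u : Oct F) * (x : Oct F)) y) (pol (x : Oct F) y) := by
  rw [gHat, coLift, smul_eq_ofF_mul, smul_eq_ofF_mul, mul_one]

/-- `(xy|z)` as a trilinear form with values in `D`. -/
noncomputable def triple (u : D.1) (x y z : perp D) : D.1 :=
  coLift u (pol ((x : Oct F) * (y : Oct F)) ((u : Oct F) * (z : Oct F))) (pol ((x : Oct F) * (y : Oct F)) z)

theorem gHat_add_left (u : D.1) (x y z : perp D) :
    gHat u (x + y) z = gHat u x z + gHat u y z := by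
  rw [gHat_eq, gHat_eq, gHat_eq, ← coLift_add, ← pol_add_left, ← pol_add_left, ← mul_add]; rfl

theorem triple_add_right (u : D.1) (x y z w : perp D) :
    triple u x y (z + w) = triple u x y z + triple u x y w := by
  rw [triple, triple, triple, ← coLift_add, ← pol_add, ← pol_add, ← mul_add]; rfl

theorem gHat_smul_left_base (u : D.1) (r : F) (x y : perp D) :
    gHat u (r • x) y = ofF D r * gHat u x y := by
  rw [gHat_eq, gHat_eq, ← coLift_mul, ← pol_smul_left, ← pol_smul_left, ← mul_smul_comm]; rfl

theorem triple_smul_right_base (u : D.1) (r : F) (x y z : perp D) :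
    triple u x y (r • z) = ofF D r * triple u x y z := by
  rw [triple, triple, ← coLift_mul, ← pol_smul, ← pol_smul, ← mul_smul_comm]; rfl

/-- Elements of `D^⊥` satisfy `x̄ = -x`, and `yz + zy` is a scalar, hence orthogonal to `x`. -/
theorem pol_perp_mul_perm (x y z : perp D) :
    pol ((x : Oct F) * (y : Oct F)) z = pol ((y : Oct F) * (z : Oct F)) x := by
  have h := congrArg (pol (x : Oct F)) (perp_mul_add_mul y z)
  rw [← neg_smul, pol_smul, pol_comm (x : Oct F) 1, perp_one_pol, mul_zero, pol_add] at h
  rw [pol_mul_right, conj_perp, mul_neg, ← neg_one_smul F, pol_smul, pol_comm _ (x : Oct F)]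
  linear_combination -h

/-- The factor `u` can be carried from one argument to another by `perp_mul_mul`. With cyclic
invariance, linearity in the last argument gives linearity in all three. -/
theorem triple_perm (u : D.1) (x y z : perp D) : triple u x y z = triple u y z x := by
  have h : pol ((x : Oct F) * (y : Oct F)) ((u : Oct F) * (z : Oct F)) = pol ((y : Oct F) * (z : Oct F)) ((u : Oct F) * (x : Oct F)) := by
    rw [pol_mul _ (u : Oct F) (x : Oct F), ← perp_mul_mul, ← coe_smul_perp, pol_perp_mul_perm]
  rw [triple, triple, h, pol_perp_mul_perm]

theorem triple_self (u : D.1) (x z : perp D) : triple u x x z = 0 := by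
  rw [triple, perp_mul_self, ← neg_smul, pol_smul_left, pol_smul_left, ← coe_smul_perp,
    perp_one_pol, perp_one_pol, mul_zero, coLift_zero]

namespace IsGenerator

variable {u : D.1} (hu : IsGenerator u)
include hu

/-- Since `ū = 1 - u`, the numerator of `coLift u a b` is `(a - b) + bu`, and `1`, `u` are
independent. -/
theorem coLift_inj {a b a' b' : F} (h : coLift u a b = coLift u a' b') : a = a' ∧ b = b' := by
  have h1 := mul_left_cancel₀ (inv_ne_zero hu.sub_conjD_ne_zero) h
  rw [hu.conjD_eq] at h1
  have h2 := hu.coords_eq_zero (a := (a - b) - (a' - b')) (b := b - b') (by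
    simp only [map_sub]; linear_combination h1)
  exact ⟨by linear_combination h2.1 + h2.2, by linear_combination h2.2⟩

/-- Matches `f(u(ux)) = f(ux) - N(u) f(x)`, which comes from `u² = u - N(u)`; this is what makes the
lifts `D`-linear. -/
theorem mul_coLift (a b : F) : u * coLift u a b = coLift u (a - N (u : Oct F) * b) a := by
  have h := hu.mul_self
  simp only [coLift, hu.conjD_eq, map_sub, map_mul]
  linear_combination (u - (1 - u))⁻¹ * ofF D b * h

theorem coLift_self (a : F) : coLift u a (2 * a) = ofF D a := by
  have h : u - (1 - u) ≠ 0 := hu.conjD_eq ▸ hu.sub_conjD_ne_zero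
  rw [coLift, inv_mul_eq_iff_eq_mul₀ hu.sub_conjD_ne_zero, hu.conjD_eq, map_mul, map_ofNat]
  ring

theorem conjD_coLift (a b : F) : conjD (coLift u a b) = coLift u (b - a) b := by
  have h : (1 - u) - (1 - (1 - u)) = -(u - (1 - u)) := by ring
  simp only [coLift, hu.conjD_eq]
  rw [← conjHom_apply]
  simp only [map_mul, map_inv₀, map_sub, map_one, conjHom_apply, conjD_ofF, hu.conjD_eq]
  rw [h, inv_neg]
  ring

theorem tr_coLift (a b : F) : tr (coLift u a b : Oct F) = b := by
  apply ofF_injective (D := D)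
  rw [← add_conjD, hu.conjD_coLift, ← coLift_add, ← hu.coLift_self]
  congr 1 <;> ring

theorem pol_u_mul_mul (w z : Oct F) : pol w ((u : Oct F) * ((u : Oct F) * (z : Oct F))) =
    pol w ((u : Oct F) * (z : Oct F)) - N (u : Oct F) * pol w z := by
  rw [left_alt, mul_self_eq, hu.tr_eq, one_smul, sub_mul, smul_mul_assoc, SplitOctonion.one_mul,
    sub_eq_add_neg, ← neg_smul, pol_add, pol_smul, neg_mul, sub_eq_add_neg]

theorem gHat_u_smul_left (x y : perp D) : gHat u (u • x) y = u * gHat u x y := by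
  rw [gHat_eq, gHat_eq, hu.mul_coLift, coe_smul_perp, pol_comm, hu.pol_u_mul_mul, pol_comm,
    pol_comm _ (x : Oct F)]

theorem triple_u_smul_right (x y z : perp D) : triple u x y (u • z) = u * triple u x y z := by
  rw [triple, triple, hu.mul_coLift, coe_smul_perp, hu.pol_u_mul_mul]

/-- As `D = F + Fu`, linearity over `D` only needs scalars from `F` and the scalar `u`. -/
theorem map_smul_of {M : Type*} [AddCommMonoid M] [Module D.1 M] (f : perp D → M)
    (hadd : ∀ x y, f (x + y) = f x + f y) (hbase : ∀ (r : F) x, f (r • x) = ofF D r • f x)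
    (hf : ∀ x, f (u • x) = u • f x) (c : D.1) (x : perp D) : f (c • x) = c • f x := by
  obtain ⟨a, b, rfl⟩ := hu.exists_coords c
  rw [add_smul, hadd, ofF_smul, hbase, mul_smul, ofF_smul, hbase, hf, add_smul, mul_smul]

theorem gHat_smul_left (c : D.1) (x y : perp D) : gHat u (c • x) y = c * gHat u x y :=
  hu.map_smul_of (fun x => gHat u x y) (fun _ _ => gHat_add_left _ _ _ _)
    (fun _ _ => gHat_smul_left_base _ _ _ _) (fun _ => hu.gHat_u_smul_left _ _) c x

theorem triple_smul_right (c : D.1) (x y z : perp D) :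
    triple u x y (c • z) = c * triple u x y z :=
  hu.map_smul_of (fun z => triple u x y z) (fun _ _ => triple_add_right _ _ _ _ _)
    (fun _ _ => triple_smul_right_base _ _ _ _ _) (fun _ => hu.triple_u_smul_right _ _ _) c z

theorem gHat_conj (x y : perp D) : conjD (gHat u x y) = gHat u y x := by
  have h : pol ((u : Oct F) * (y : Oct F)) x = pol (x : Oct F) y - pol ((u : Oct F) * (x : Oct F)) y := by
    have h1 : conj (u : Oct F) * (x : Oct F) = x + (-1 : F) • ((u : Oct F) * (x : Oct F)) := by
      rw [← coe_conjD, hu.conjD_eq, neg_one_smul, ← sub_eq_add_neg]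
      change (1 - (u : Oct F)) * (x : Oct F) = _
      rw [sub_mul, SplitOctonion.one_mul]
    rw [pol_mul_left, h1, pol_comm, pol_add_left, pol_smul_left]
    ring
  rw [gHat_eq, gHat_eq, hu.conjD_coLift, pol_comm (y : Oct F) x, h]

theorem gHat_add_right (x y z : perp D) : gHat u x (y + z) = gHat u x y + gHat u x z := by
  rw [← hu.gHat_conj, gHat_add_left, conjD_add, hu.gHat_conj, hu.gHat_conj]

theorem gHat_smul_right (c : D.1) (x y : perp D) :
    gHat u x (c • y) = conjD c * gHat u x y := by
  rw [← hu.gHat_conj, hu.gHat_smul_left, conjD_mul, hu.gHat_conj]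

theorem gHat_self (x : perp D) : gHat u x x = ofF D (N (x : Oct F)) := by
  have h : pol ((u : Oct F) * (x : Oct F)) x = N (x : Oct F) := by
    have := pol_mul_mul_right (u : Oct F) x 1
    rwa [SplitOctonion.one_mul, pol_comm (u : Oct F), pol_one, hu.tr_eq, mul_one] at this
  rw [gHat_eq, h, pol_self, hu.coLift_self]

/-- Preservation of `ĝ` amounts to preservation of the polar form. -/
theorem gHat_eq_iff {x y x' y' : perp D} : gHat u x y = gHat u x' y' ↔
    pol ((u : Oct F) * (x : Oct F)) y = pol ((u : Oct F) * (x' : Oct F)) y' ∧ pol (x : Oct F) y = pol (x' : Oct F) y' := by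
  rw [gHat_eq, gHat_eq]
  exact ⟨hu.coLift_inj, fun h => by rw [h.1, h.2]⟩

theorem eq_zero_of_gHat {x : perp D} (h : ∀ y, gHat u x y = 0) : x = 0 := by
  refine perp_eq_zero_of_pol fun y => ?_
  have := h y
  rw [gHat_eq, ← coLift_zero u] at this
  exact (hu.coLift_inj this).2

/-- The component of `xy` in `D` is `-ĝ(x,y)`. Orthogonality is tested on `1` and `u`, which span
`D`. -/
theorem mul_add_gHat_mem (x y : perp D) : (x : Oct F) * (y : Oct F) + (gHat u x y : Oct F) ∈ perp D := by
  have h1 : pol 1 ((x : Oct F) * (y : Oct F) + (gHat u x y : Oct F)) = 0 := by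
    rw [pol_add, pol_mul, SplitOctonion.mul_one, conj_perp, ← neg_one_smul F, pol_smul_left,
      pol_one, gHat_eq, hu.tr_coLift]
    ring
  have h2 : pol (u : Oct F) ((x : Oct F) * (y : Oct F) + (gHat u x y : Oct F)) = 0 := by
    have h3 : pol (u : Oct F) (gHat u x y : Oct F) =
        pol (x : Oct F) y - pol ((u : Oct F) * (x : Oct F)) y := by
      have h5 : pol (u : Oct F) (gHat u x y : Oct F) = tr (conj (u : Oct F) * (gHat u x y : Oct F)) := by
        rw [← pol_one, ← pol_mul_left, SplitOctonion.mul_one]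
      rw [h5, ← coe_conjD, ← coe_mul, hu.conjD_eq, sub_mul, one_mul, gHat_eq, hu.mul_coLift,
        ← coLift_sub, hu.tr_coLift]
    have h4 : conj (x : Oct F) * u = (u : Oct F) * (x : Oct F) - x := by
      rw [conj_perp, neg_mul, perp_mul, ← coe_conjD, hu.conjD_eq]
      change -((1 - (u : Oct F)) * (x : Oct F)) = _
      rw [sub_mul, SplitOctonion.one_mul, neg_sub]
    rw [pol_add, h3, pol_mul, h4, sub_eq_add_neg, ← neg_one_smul F (x : Oct F), pol_add_left,
      pol_smul_left]
    ring
  intro d hd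
  obtain ⟨a, b, hab⟩ := hu.exists_coords ⟨d, hd⟩
  have : d = a • (1 : Oct F) + b • (u : Oct F) := by
    have := congrArg Subtype.val hab
    rw [← smul_eq_ofF_mul] at this
    exact this
  rw [this, pol_add_left, pol_smul_left, pol_smul_left, h1, h2, mul_zero, mul_zero, add_zero]

/-- The component of the product of two elements of `D^⊥` in `D^⊥`. -/
noncomputable def cross (x y : perp D) : perp D :=
  ⟨(x : Oct F) * (y : Oct F) + (gHat u x y : Oct F), hu.mul_add_gHat_mem x y⟩

theorem coe_cross (x y : perp D) :
    (hu.cross x y : Oct F) = (x : Oct F) * (y : Oct F) + (gHat u x y : Oct F) := rfl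

theorem gHat_cross (x y z : perp D) : gHat u z (hu.cross x y) = triple u x y z := by
  have h (w : perp D) : pol (w : Oct F) (hu.cross x y) = pol ((x : Oct F) * (y : Oct F)) w := by
    rw [coe_cross, pol_add, pol_comm _ (gHat u x y : Oct F), w.2 _ (gHat u x y).2, add_zero,
      pol_comm]
  rw [gHat_eq, h, ← coe_smul_perp, h]; rfl

/-- Multiplicativity of the norm applied to the orthogonal splitting of `xy`; the right-hand side is
the Gram determinant of `x`, `y`. -/
theorem N_cross (x y : perp D) : N (hu.cross x y : Oct F) =
    N (x : Oct F) * N (y : Oct F) - N (gHat u x y : Oct F) := by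
  have h : (x : Oct F) * (y : Oct F) = (hu.cross x y : Oct F) + (-1 : F) • (gHat u x y : Oct F) := by
    rw [coe_cross, neg_one_smul, add_neg_cancel_right]
  have h2 := N_mul (x : Oct F) y
  rw [h, N_add, N_smul, pol_smul, pol_comm, (hu.cross x y).2 _ (gHat u x y).2] at h2
  linear_combination h2

/-- The trilinear form `triple` is alternating. -/
noncomputable def tripleMap : (perp D) [⋀^Fin 3]→ₗ[D.1] D.1 where
  toFun v := triple u (v 0) (v 1) (v 2)
  map_update_add' v i x y := by
    have h0 (x y z w : perp D) : triple u (x + y) z w = triple u x z w + triple u y z w := by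
      rw [triple_perm u (x + y), triple_perm u x, triple_perm u y, triple_add_right]
    have h1 (x y z w : perp D) : triple u z (x + y) w = triple u z x w + triple u z y w := by
      rw [← triple_perm u w, ← triple_perm u w, ← triple_perm u w, triple_add_right]
    rename_i inst
    obtain rfl : inst = instDecidableEqFin 3 := Subsingleton.elim _ _
    fin_cases i <;> simp [h0, h1, triple_add_right]
  map_update_smul' v i c x := by
    have h0 (c : D.1) (x y z : perp D) : triple u (c • x) y z = c * triple u x y z := by
      rw [triple_perm u (c • x), hu.triple_smul_right, ← triple_perm u x]
    have h1 (c : D.1) (x y z : perp D) : triple u y (c • x) z = c * triple u y x z := by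
      rw [← triple_perm u z, hu.triple_smul_right, ← triple_perm u z]
    rename_i inst
    obtain rfl : inst = instDecidableEqFin 3 := Subsingleton.elim _ _
    fin_cases i <;> simp [h0, h1, hu.triple_smul_right]
  map_eq_zero_of_eq' v i j h hij := by
    have h1 (x y : perp D) : triple u x y x = 0 := by
      rw [← triple_perm, triple_self]
    have h2 (x y : perp D) : triple u x y y = 0 := by
      rw [triple_perm, triple_self]
    fin_cases i <;> fin_cases j <;> simp_all [triple_self]

theorem tripleMap_apply (v : Fin 3 → perp D) : hu.tripleMap v = triple u (v 0) (v 1) (v 2) := rfl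

end IsGenerator

end Hermitian

/-! ### Restriction to `D^⊥` as an isomorphism from the stabilizer onto SU -/

section Restriction

variable {F : Type u} [Field F] {D : calD F}

variable (D) in
theorem exists_perp_N_ne_zero : ∃ x : perp D, N (x : Oct F) ≠ 0 := by
  by_contra! h
  have h0 (x : perp D) : x = 0 := perp_eq_zero_of_pol fun y => by
    have := N_add (x : Oct F) y
    rwa [h, h, ← Submodule.coe_add, h, zero_add, zero_add, eq_comm] at this
  have : Subsingleton (perp D) := ⟨fun x y => (h0 x).trans (h0 y).symm⟩
  have h3 := finrank_perp D
  rw [Module.finrank_zero_of_subsingleton] at h3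
  omega

namespace IsGenerator

variable {u : D.1} (hu : IsGenerator u)
include hu

theorem gHat_sub_left (x y z : perp D) : gHat u (x - y) z = gHat u x z - gHat u y z := by
  rw [sub_eq_add_neg, gHat_add_left, ← neg_one_smul D.1, hu.gHat_smul_left, neg_one_mul,
    sub_eq_add_neg]

theorem eq_of_gHat_right {x y : perp D} (h : ∀ z, gHat u z x = gHat u z y) : x = y := by
  rw [← sub_eq_zero]
  refine hu.eq_zero_of_gHat fun z => ?_
  rw [hu.gHat_sub_left, ← hu.gHat_conj z, ← hu.gHat_conj z, h, sub_self]

theorem tr_gHat (x y : perp D) : tr (gHat u x y : Oct F) = pol (x : Oct F) y := by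
  rw [gHat_eq, hu.tr_coLift]

/-- Otherwise the norm vanishes on the `ĝ`-complement of `x`, so this complement lies in the radical
of the polar form and is zero. Then `x` alone would span the three-dimensional space `D^⊥`. -/
theorem exists_orthogonal_N_ne_zero {x : perp D} (hx : N (x : Oct F) ≠ 0) :
    ∃ y : perp D, gHat u x y = 0 ∧ N (y : Oct F) ≠ 0 := by
  by_contra! h
  have hx' : gHat u x x ≠ 0 := by
    rw [hu.gHat_self]; exact fun h0 => hx (ofF_injective (D := D) (h0.trans (map_zero _).symm))
  have horth (y : perp D) : gHat u x (y - (gHat u y x * (gHat u x x)⁻¹) • x) = 0 := by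
    rw [← hu.gHat_conj, hu.gHat_sub_left, hu.gHat_smul_left, mul_assoc, inv_mul_cancel₀ hx',
      mul_one, sub_self, ← conjHom_apply, map_zero]
  have hz (y : perp D) (hy : gHat u x y = 0) : y = 0 := by
    have hyy (z : perp D) (hz : gHat u x z = 0) : pol (y : Oct F) z = 0 := by
      have := N_add (y : Oct F) z
      rwa [h y hy, h z hz, ← Submodule.coe_add, h _ (by rw [hu.gHat_add_right, hy, hz, add_zero]),
        zero_add, zero_add, eq_comm] at this
    refine perp_eq_zero_of_pol fun z => ?_
    rw [← sub_add_cancel z ((gHat u z x * (gHat u x x)⁻¹) • x), Submodule.coe_add, pol_add,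
      hyy _ (horth z), zero_add]
    rw [pol_comm, ← hu.tr_gHat, hu.gHat_smul_left, hy, mul_zero, ← pol_one]
    exact pol_zero 1
  have h1 := finrank_le_one (R := D.1) x fun y =>
    ⟨gHat u y x * (gHat u x x)⁻¹, (sub_eq_zero.1 (hz _ (horth y))).symm⟩
  rw [finrank_perp D] at h1
  omega

theorem triple_cross (x y : perp D) :
    triple u x y (hu.cross x y) = ofF D (N (hu.cross x y : Oct F)) := by
  rw [← hu.gHat_cross, hu.gHat_self]

theorem gHat_left_cross (x y : perp D) : gHat u x (hu.cross x y) = 0 := by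
  rw [hu.gHat_cross, ← triple_perm, triple_self]

theorem gHat_right_cross (x y : perp D) : gHat u y (hu.cross x y) = 0 := by
  rw [hu.gHat_cross, triple_perm, triple_self]

/-- An alternating form vanishes on dependent vectors, but its value at `x`, `y`, `x × y` is `N(x ×
y)`. -/
theorem linearIndependent_cross {x y : perp D} (h : N (hu.cross x y : Oct F) ≠ 0) :
    LinearIndependent D.1 ![x, y, hu.cross x y] := by
  by_contra hli
  have h1 := hu.tripleMap.map_linearDependent _ hli
  rw [tripleMap_apply] at h1
  change triple u x y (hu.cross x y) = 0 at h1
  rw [hu.triple_cross, map_eq_zero] at h1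
  exact h h1

/-- The basis `x, y, x × y` of `D^⊥`. -/
noncomputable def crossBasis {x y : perp D} (h : N (hu.cross x y : Oct F) ≠ 0) :
    Module.Basis (Fin 3) D.1 (perp D) :=
  basisOfLinearIndependentOfCardEqFinrank (hu.linearIndependent_cross h)
    (by rw [finrank_perp, Fintype.card_fin])

theorem coe_crossBasis {x y : perp D} (h : N (hu.cross x y : Oct F) ≠ 0) :
    ⇑(hu.crossBasis h) = ![x, y, hu.cross x y] :=
  coe_basisOfLinearIndependentOfCardEqFinrank _ _

/-- In top degree every alternating form is a multiple of the determinant of a basis. -/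
theorem tripleMap_map (e : Module.Basis (Fin 3) D.1 (perp D)) (φ : perp D ≃ₗ[D.1] perp D)
    (v : Fin 3 → perp D) :
    hu.tripleMap (φ ∘ v) = (LinearEquiv.det φ : D.1) * hu.tripleMap v := by
  rw [hu.tripleMap.eq_smul_basis_det e, AlternatingMap.smul_apply, AlternatingMap.smul_apply,
    LinearEquiv.coe_det, smul_eq_mul, smul_eq_mul, mul_left_comm, ← Module.Basis.det_comp]
  rfl

theorem triple_map (φ : perp D ≃ₗ[D.1] perp D) (x y z : perp D) :
    triple u (φ x) (φ y) (φ z) = (LinearEquiv.det φ : D.1) * triple u x y z :=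
  hu.tripleMap_map (Module.finBasisOfFinrankEq _ _ (finrank_perp D)) φ ![x, y, z]

theorem det_eq_one_of_triple {φ : perp D ≃ₗ[D.1] perp D} {x y z : perp D}
    (h0 : triple u x y z ≠ 0) (h : triple u (φ x) (φ y) (φ z) = triple u x y z) :
    LinearEquiv.det φ = 1 := by
  rw [hu.triple_map] at h
  exact Units.ext (mul_right_cancel₀ h0 (h.trans (one_mul _).symm))

theorem exists_triple_ne_zero : ∃ x y z : perp D, triple u x y z ≠ 0 := by
  obtain ⟨x, hx⟩ := exists_perp_N_ne_zero D
  obtain ⟨y, hxy, hy⟩ := hu.exists_orthogonal_N_ne_zero hx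
  refine ⟨x, y, hu.cross x y, ?_⟩
  rw [hu.triple_cross, hu.N_cross, hxy]
  change ofF D (_ - N (0 : Oct F)) ≠ 0
  rw [N_zero, sub_zero, map_ne_zero]
  exact mul_ne_zero hx hy

/-- The vector `x × y` represents the form `triple u x y` through the nondegenerate `ĝ`, and `φ`
preserves both. -/
theorem map_cross {φ : perp D ≃ₗ[D.1] perp D} (hφ : φ ∈ SU u) (x y : perp D) :
    φ (hu.cross x y) = hu.cross (φ x) (φ y) := by
  refine hu.eq_of_gHat_right fun z => ?_
  obtain ⟨z, rfl⟩ := φ.surjective z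
  rw [hφ.1, hu.gHat_cross, hu.gHat_cross, hu.triple_map, hφ.2, Units.val_one, one_mul]

theorem coe_eq_of_mem (c : D.1) : ∃ a b : F, (c : Oct F) = a • (1 : Oct F) + b • (u : Oct F) := by
  obtain ⟨a, b, rfl⟩ := hu.exists_coords c
  exact ⟨a, b, by rw [← smul_eq_ofF_mul]; rfl⟩

end IsGenerator

theorem mem_Aut {α : Oct F ≃ₗ[F] Oct F} : α ∈ Aut F ↔ ∀ x y, α (x * y) = α x * α y := Iff.rfl

theorem Aut_one {α : Oct F ≃ₗ[F] Oct F} (hα : α ∈ Aut F) : α 1 = 1 := by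
  have h := hα 1 (α.symm 1)
  rw [SplitOctonion.one_mul, α.apply_symm_apply, SplitOctonion.mul_one] at h
  exact h.symm

/-- For non-scalar `x` the equation `x² = tr(x)x - N(x)` determines its coefficients, and `α`
transports it. -/
theorem Aut_N {α : Oct F ≃ₗ[F] Oct F} (hα : α ∈ Aut F) (x : Oct F) : N (α x) = N x := by
  by_cases hx : ∃ a : F, x = a • (1 : Oct F)
  · obtain ⟨a, rfl⟩ := hx
    rw [map_smul, Aut_one hα]
  · have h1 := mul_self_eq (α x)
    rw [← hα, mul_self_eq x, map_sub, map_smul, map_smul, Aut_one hα] at h1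
    have h2 : (tr x - tr (α x)) • α x = (N x - N (α x)) • (1 : Oct F) := by
      rw [sub_smul, sub_smul, sub_eq_sub_iff_sub_eq_sub, h1]
    by_cases ht : tr x - tr (α x) = 0
    · rw [ht, zero_smul, eq_comm, smul_eq_zero, sub_eq_zero] at h2
      exact (h2.resolve_right one_ne_zero').symm
    · refine absurd ⟨(tr x - tr (α x))⁻¹ * (N x - N (α x)), α.injective ?_⟩ hx
      rw [map_smul, Aut_one hα, mul_smul, ← h2, smul_smul, inv_mul_cancel₀ ht, one_smul]

theorem Aut_pol {α : Oct F ≃ₗ[F] Oct F} (hα : α ∈ Aut F) (x y : Oct F) :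
    pol (α x) (α y) = pol x y := by
  simp only [pol, QuadraticMap.polar, ← map_add, Aut_N hα]

namespace IsGenerator

variable {u : D.1} (hu : IsGenerator u)
include hu

theorem stab_apply {α : Oct F ≃ₗ[F] Oct F} (hα : α ∈ stab (u : Oct F)) {c : Oct F}
    (hc : c ∈ D.1) : α c = c := by
  obtain ⟨a, b, hab⟩ := hu.coe_eq_of_mem ⟨c, hc⟩
  change c = _ at hab
  rw [hab, map_add, map_smul, map_smul, Aut_one hα.1, hα.2]

theorem stab_mem_perp {α : Oct F ≃ₗ[F] Oct F} (hα : α ∈ stab (u : Oct F)) {x : Oct F}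
    (hx : x ∈ perp D) : α x ∈ perp D := fun d hd => by
  rw [← hu.stab_apply hα hd, Aut_pol hα.1, hx d hd]

/-- The restriction to `D^⊥` of an automorphism which fixes `D` pointwise. -/
noncomputable def restrict (α : stab (u : Oct F)) : perp D ≃ₗ[D.1] perp D where
  toFun x := ⟨α.1 x, hu.stab_mem_perp α.2 x.2⟩
  invFun x := ⟨α.1.symm x, hu.stab_mem_perp ((stab (u : Oct F)).inv_mem α.2) x.2⟩
  map_add' x y := Subtype.ext (map_add α.1 _ _)
  map_smul' c x := Subtype.ext <| by
    change α.1 ((c : Oct F) * (x : Oct F)) = (c : Oct F) * α.1 x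
    rw [α.2.1, hu.stab_apply α.2 c.2]
  left_inv x := Subtype.ext (α.1.symm_apply_apply _)
  right_inv x := Subtype.ext (α.1.apply_symm_apply _)

theorem coe_restrict (α : stab (u : Oct F)) (x : perp D) :
    (hu.restrict α x : Oct F) = α.1 (x : Oct F) := rfl

theorem restrict_mem (α : stab (u : Oct F)) : hu.restrict α ∈ SU u := by
  have hα : ∀ x y, α.1 (x * y) = α.1 x * α.1 y := α.2.1
  have hu' : α.1 (u : Oct F) = u := α.2.2
  refine ⟨fun x y => hu.gHat_eq_iff.2 ⟨?_, Aut_pol α.2.1 _ _⟩, ?_⟩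
  · rw [coe_restrict, coe_restrict, ← Aut_pol α.2.1 ((u : Oct F) * (x : Oct F)), hα, hu']
  · obtain ⟨x, y, z, h⟩ := hu.exists_triple_ne_zero
    refine hu.det_eq_one_of_triple h ?_
    rw [triple, triple, ← Aut_pol α.2.1 ((x : Oct F) * (y : Oct F)),
      ← Aut_pol α.2.1 ((x : Oct F) * (y : Oct F)), hα, hα, hu']
    rfl

/-- Restriction to `D^⊥` as a group homomorphism. -/
noncomputable def restrictHom : stab (u : Oct F) →* SU u where
  toFun α := ⟨hu.restrict α, hu.restrict_mem α⟩
  map_one' := rfl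
  map_mul' _ _ := rfl

theorem restrictHom_injective : Function.Injective hu.restrictHom := by
  intro α β h
  refine Subtype.ext (LinearEquiv.ext fun s => ?_)
  obtain ⟨c, x, rfl⟩ := exists_add_perp (D := D) s
  have h1 : α.1 (x : Oct F) = β.1 (x : Oct F) :=
    congrArg (fun φ : SU u => ((φ.1 x : perp D) : Oct F)) h
  rw [map_add, map_add, hu.stab_apply α.2 c.2, hu.stab_apply β.2 c.2, h1]

end IsGenerator

/-- The extension of a linear bijection of `D^⊥` by the identity on `D`. -/
noncomputable def extend (φ : perp D ≃ₗ[D.1] perp D) : Oct F ≃ₗ[F] Oct F :=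
  (Submodule.prodEquivOfIsCompl _ _ (isCompl_perp D)).symm ≪≫ₗ
    ((LinearEquiv.refl F D.1.toSubmodule).prodCongr (φ.restrictScalars F)) ≪≫ₗ
      Submodule.prodEquivOfIsCompl _ _ (isCompl_perp D)

theorem extend_apply (φ : perp D ≃ₗ[D.1] perp D) (c : D.1) (x : perp D) :
    extend φ ((c : Oct F) + x) = (c : Oct F) + φ x := by
  have h : (Submodule.prodEquivOfIsCompl _ _ (isCompl_perp D)).symm ((c : Oct F) + (x : Oct F)) =
      (c, x) := by
    rw [LinearEquiv.symm_apply_eq]; rfl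
  rw [extend, LinearEquiv.trans_apply, LinearEquiv.trans_apply, h]; rfl

theorem extend_coe (φ : perp D ≃ₗ[D.1] perp D) (c : D.1) : extend φ (c : Oct F) = c := by
  have := extend_apply φ c 0
  rwa [map_zero, Submodule.coe_zero, add_zero] at this

theorem extend_perp (φ : perp D ≃ₗ[D.1] perp D) (x : perp D) : extend φ (x : Oct F) = φ x := by
  have := extend_apply φ 0 x
  rwa [ZeroMemClass.coe_zero, zero_add, zero_add] at this

namespace IsGenerator

variable {u : D.1} (hu : IsGenerator u)
include hu

theorem extend_mem {φ : perp D ≃ₗ[D.1] perp D} (hφ : φ ∈ SU u) : extend φ ∈ stab (u : Oct F) := by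
  refine ⟨fun s t => ?_, extend_coe φ u⟩
  obtain ⟨c, x, rfl⟩ := exists_add_perp (D := D) s
  obtain ⟨d, y, rfl⟩ := exists_add_perp (D := D) t
  have key (x y : perp D) : (x : Oct F) * (y : Oct F) =
      ((-gHat u x y : D.1) : Oct F) + (hu.cross x y : Oct F) := by
    rw [coe_cross]; change _ = -(gHat u x y : Oct F) + _; abel
  -- The octonion product expressed solely by data that elements of SU respect.
  have h1 (x y : perp D) : ((c : Oct F) + (x : Oct F)) * ((d : Oct F) + (y : Oct F)) =
      ((c * d - gHat u x y : D.1) : Oct F) + ((conjD d • x + c • y + hu.cross x y : perp D) : Oct F) := by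
    rw [sub_eq_add_neg]
    change _ = (((c : Oct F) * (d : Oct F)) + ((-gHat u x y : D.1) : Oct F)) +
      ((conj (d : Oct F) * (x : Oct F) + (c : Oct F) * (y : Oct F)) + (hu.cross x y : Oct F))
    rw [add_mul, mul_add, mul_add, perp_mul, key]
    abel
  rw [h1, extend_apply, extend_apply, extend_apply, h1, hφ.1, map_add, map_add, map_smul, map_smul,
    hu.map_cross hφ]

theorem restrictHom_surjective : Function.Surjective hu.restrictHom := fun φ =>
  ⟨⟨extend φ.1, hu.extend_mem φ.2⟩,
    Subtype.ext (LinearEquiv.ext fun x => Subtype.ext (extend_perp φ.1 x))⟩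

end IsGenerator

end Restriction

/-! ### Isotropic lines, the subalgebras containing `D`, and double transitivity -/

section Geometry

variable {F : Type u} [Field F] {D : calD F}

namespace IsGenerator

variable {u : D.1} (hu : IsGenerator u)
include hu

theorem crossBasis_span {x y : perp D} (h : N (hu.cross x y : Oct F) ≠ 0) (v : perp D) :
    ∃ a b c : D.1, v = a • x + b • y + c • hu.cross x y := by
  refine ⟨(hu.crossBasis h).repr v 0, (hu.crossBasis h).repr v 1, (hu.crossBasis h).repr v 2, ?_⟩
  have := (hu.crossBasis h).sum_repr v
  rw [Fin.sum_univ_three, coe_crossBasis] at this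
  exact this.symm

/-- An isometry is determined by the images of two vectors that span a nondegenerate plane, and
these images may be prescribed. -/
theorem exists_mem_SU {x y x' y' : perp D} (hx : N (x' : Oct F) = N (x : Oct F))
    (hy : N (y' : Oct F) = N (y : Oct F)) (hxy : gHat u x' y' = gHat u x y)
    (h : N (hu.cross x y : Oct F) ≠ 0) : ∃ φ ∈ SU u, φ x = x' ∧ φ y = y' := by
  have hz : N (hu.cross x' y' : Oct F) = N (hu.cross x y : Oct F) := by
    rw [hu.N_cross, hu.N_cross, hx, hy, hxy]
  have h' : N (hu.cross x' y' : Oct F) ≠ 0 := hz ▸ h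
  let φ := (hu.crossBasis h).equiv (hu.crossBasis h') (Equiv.refl _)
  have hφ (i : Fin 3) : φ (![x, y, hu.cross x y] i) = ![x', y', hu.cross x' y'] i := by
    have := (hu.crossBasis h).equiv_apply i (hu.crossBasis h') (Equiv.refl _)
    rwa [coe_crossBasis, coe_crossBasis] at this
  have h0 : φ x = x' := hφ 0
  have h1 : φ y = y' := hφ 1
  have h2 : φ (hu.cross x y) = hu.cross x' y' := hφ 2
  have hyx : gHat u y' x' = gHat u y x := by rw [← hu.gHat_conj, hxy, hu.gHat_conj]
  have hc (x y : perp D) : gHat u (hu.cross x y) x = 0 := by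
    rw [← hu.gHat_conj, hu.gHat_left_cross, ← conjHom_apply, map_zero]
  have hc' (x y : perp D) : gHat u (hu.cross x y) y = 0 := by
    rw [← hu.gHat_conj, hu.gHat_right_cross, ← conjHom_apply, map_zero]
  -- The cross product is orthogonal to both factors and its norm depends only on their Gram matrix,
  -- so the two bases have equal Gram matrices. The determinant is 1 because the determinant form
  -- takes the values `N(x × y) = N(x' × y')` on them.
  refine ⟨φ, ⟨fun v w => ?_, ?_⟩, h0, h1⟩
  · obtain ⟨a, b, c, rfl⟩ := hu.crossBasis_span h v
    obtain ⟨a', b', c', rfl⟩ := hu.crossBasis_span h w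
    simp only [map_add, map_smul, h0, h1, h2, gHat_add_left, hu.gHat_add_right, hu.gHat_smul_left,
      hu.gHat_smul_right, hu.gHat_self, hx, hy, hz, hxy, hyx, hc, hc', hu.gHat_left_cross,
      hu.gHat_right_cross]
  · refine hu.det_eq_one_of_triple (x := x) (y := y) (z := hu.cross x y) ?_ ?_
    · rw [hu.triple_cross, map_ne_zero]; exact h
    · rw [h0, h1, h2, hu.triple_cross, hu.triple_cross, hz]

/-- The hermitian form `ĝ` has Witt index at most one. -/
theorem exists_smul_eq_of_isotropic {x z : perp D} (hx : N (x : Oct F) = 0) (hx0 : x ≠ 0)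
    (hz : N (z : Oct F) = 0) (hxz : gHat u x z = 0) : ∃ c : D.1, z = c • x := by
  obtain ⟨y, hy⟩ : ∃ y, gHat u x y ≠ 0 := by
    by_contra! h
    exact hx0 (hu.eq_zero_of_gHat h)
  -- As `x` is isotropic, `N(x × y) = -N(ĝ(x,y))`, which is non-zero by anisotropy of `D`.
  have hN : N (hu.cross x y : Oct F) ≠ 0 := by
    rw [hu.N_cross, hx, zero_mul, zero_sub, neg_ne_zero]
    exact N_coe_ne_zero hy
  obtain ⟨a, b, c, rfl⟩ := hu.crossBasis_span hN z
  have hb : b = 0 := by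
    rw [hu.gHat_add_right, hu.gHat_add_right, hu.gHat_smul_right, hu.gHat_smul_right,
      hu.gHat_smul_right, hu.gHat_self, hx, map_zero, mul_zero, zero_add, hu.gHat_left_cross,
      mul_zero, add_zero, mul_eq_zero, or_iff_left hy, ← conjHom_apply, map_eq_zero] at hxz
    exact hxz
  subst hb
  -- With `b = 0`, only the term `c c̄ N(x × y)` survives in `ĝ(z,z) = 0`.
  have hc : c = 0 := by
    have h1 := hu.gHat_self (a • x + (0 : D.1) • y + c • hu.cross x y)
    have h2 : gHat u (hu.cross x y) x = 0 := by
      rw [← hu.gHat_conj, hu.gHat_left_cross, ← conjHom_apply, map_zero]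
    rw [hz, map_zero, zero_smul, add_zero, gHat_add_left, hu.gHat_add_right, hu.gHat_add_right] at h1
    simp only [hu.gHat_smul_left, hu.gHat_smul_right, hu.gHat_left_cross, h2, hu.gHat_self, hx,
      map_zero, mul_zero, zero_add, mul_eq_zero] at h1
    rcases h1 with h1 | h1 | h1
    · exact h1
    · rwa [← conjHom_apply, map_eq_zero] at h1
    · rw [map_eq_zero] at h1
      exact absurd h1 hN
  exact ⟨a, by rw [hc, zero_smul, zero_smul, add_zero, add_zero]⟩

end IsGenerator

theorem mem_leftMultiples {z s : Oct F} :
    s ∈ leftMultiples D z ↔ ∃ c : D.1, (c : Oct F) * z = s :=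
  ⟨fun ⟨c, hc, h⟩ => ⟨⟨c, hc⟩, h⟩, fun ⟨c, h⟩ => ⟨c, c.2, h⟩⟩

theorem leftMultiples_le_perp (x : perp D) : leftMultiples D (x : Oct F) ≤ perp D := by
  intro s hs
  obtain ⟨c, rfl⟩ := mem_leftMultiples.1 hs
  exact (c • x).2

theorem leftMultiples_smul {c : D.1} (hc : c ≠ 0) (x : perp D) :
    leftMultiples D ((c • x : perp D) : Oct F) = leftMultiples D (x : Oct F) := by
  ext s
  rw [mem_leftMultiples, mem_leftMultiples]
  constructor
  · rintro ⟨d, rfl⟩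
    exact ⟨d * c, smul_assoc_of_mem D d.2 c.2 x⟩
  · rintro ⟨d, rfl⟩
    refine ⟨d * c⁻¹, ?_⟩
    change (((d * c⁻¹) • c • x : perp D) : Oct F) = ((d • x : perp D) : Oct F)
    rw [smul_smul, inv_mul_cancel_right₀ hc]

namespace IsGenerator

variable {u : D.1} (hu : IsGenerator u)
include hu

theorem map_leftMultiples {α : Oct F ≃ₗ[F] Oct F} (hα : α ∈ stab (u : Oct F)) (z : Oct F) :
    (leftMultiples D z).map (α : Oct F →ₗ[F] Oct F) = leftMultiples D (α z) := by
  ext s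
  simp only [Submodule.mem_map, mem_leftMultiples, LinearEquiv.coe_coe]
  constructor
  · rintro ⟨_, ⟨c, rfl⟩, rfl⟩
    exact ⟨c, by rw [mem_Aut.1 hα.1, hu.stab_apply hα c.2]⟩
  · rintro ⟨c, rfl⟩
    exact ⟨_, ⟨c, rfl⟩, by rw [mem_Aut.1 hα.1, hu.stab_apply hα c.2]⟩

theorem map_subfield {α : Oct F ≃ₗ[F] Oct F} (hα : α ∈ stab (u : Oct F)) :
    D.1.toSubmodule.map (α : Oct F →ₗ[F] Oct F) = D.1.toSubmodule := by
  ext s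
  rw [Submodule.mem_map]
  constructor
  · rintro ⟨c, hc, rfl⟩
    exact (hu.stab_apply hα hc).symm ▸ hc
  · exact fun hs => ⟨s, hs, hu.stab_apply hα hs⟩

/-- Two distinct isotropic lines have representatives `x`, `y` with `ĝ(x, y) = 1`. -/
theorem exists_hyperbolic_pair {V W : Submodule F (Oct F)} (hV : V ∈ isotropicLines D)
    (hW : W ∈ isotropicLines D) (hne : V ≠ W) : ∃ x y : perp D, N (x : Oct F) = 0 ∧
      N (y : Oct F) = 0 ∧ gHat u x y = 1 ∧ V = leftMultiples D (x : Oct F) ∧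
      W = leftMultiples D (y : Oct F) := by
  obtain ⟨x, hx, hx0, hNx, rfl⟩ := hV
  obtain ⟨y, hy, hy0, hNy, rfl⟩ := hW
  lift x to perp D using hx
  lift y to perp D using hy
  have hg : gHat u x y ≠ 0 := by
    intro h
    obtain ⟨c, hc⟩ := hu.exists_smul_eq_of_isotropic hNx
      (fun h => hx0 (congrArg Subtype.val h)) hNy h
    have hc0 : c ≠ 0 := by
      rintro rfl
      exact hy0 (congrArg Subtype.val (hc.trans (zero_smul _ _)))
    exact hne (hc ▸ (leftMultiples_smul hc0 x).symm)
  refine ⟨(gHat u x y)⁻¹ • x, y, ?_, hNy, ?_, (leftMultiples_smul (inv_ne_zero hg) x).symm, rfl⟩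
  · rw [coe_smul_perp, N_mul, hNx, mul_zero]
  · rw [hu.gHat_smul_left, inv_mul_cancel₀ hg]

theorem isotropicLines_doublyTransitive :
    ActsDoublyTransitively (stab (u : Oct F)) (isotropicLines D) := by
  refine ⟨?_, ?_⟩
  · rintro α hα V ⟨x, hx, hx0, hN, rfl⟩
    exact ⟨α x, hu.stab_mem_perp hα hx, fun h => hx0 (α.map_eq_zero_iff.1 h),
      (Aut_N hα.1 x).trans hN, hu.map_leftMultiples hα x⟩
  · intro V₁ hV₁ V₂ hV₂ W₁ hW₁ W₂ hW₂ hV hW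
    obtain ⟨x, y, hx, hy, hxy, rfl, rfl⟩ := hu.exists_hyperbolic_pair hV₁ hV₂ hV
    obtain ⟨x', y', hx', hy', hxy', rfl, rfl⟩ := hu.exists_hyperbolic_pair hW₁ hW₂ hW
    obtain ⟨φ, hφ, rfl, rfl⟩ := hu.exists_mem_SU (hx'.trans hx.symm) (hy'.trans hy.symm)
      -- For a hyperbolic pair the Gram determinant is `-N(1) = -1`.
      (hxy'.trans hxy.symm) (by
        rw [hu.N_cross, hx, hxy, coe_one, N_one]; simp)
    refine ⟨extend φ, hu.extend_mem hφ, ?_, ?_⟩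
    · rw [hu.map_leftMultiples (hu.extend_mem hφ), extend_perp]
    · rw [hu.map_leftMultiples (hu.extend_mem hφ), extend_perp]

/-- The scalar `d` can be moved out by `perp_mul_mul`, and `(cx)x = -x(cx) = -c̄(xx) = 0`. -/
theorem isotropic_mul_mul {x : perp D} (hx : N (x : Oct F) = 0) (c d : D.1) :
    ((c : Oct F) * (x : Oct F)) * ((d : Oct F) * (x : Oct F)) = 0 := by
  have h : (x : Oct F) * (x : Oct F) = 0 := by rw [perp_mul_self, hx, zero_smul, neg_zero]
  have h1 := perp_mul_mul (c • x) d x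
  rw [coe_smul_perp] at h1
  have h2 := perp_mul_add_mul (c • x) x
  have h3 : pol ((c • x : perp D) : Oct F) x = 0 := by
    rw [← hu.tr_gHat, hu.gHat_smul_left, hu.gHat_self, hx, map_zero, mul_zero, ← pol_one]
    exact pol_zero 1
  rw [h3, zero_smul, neg_zero, coe_smul_perp, perp_mul_mul, h, mul_zero, add_zero] at h2
  rw [h1, h2, mul_zero]

/-- The subalgebra `D + Dx`, for an isotropic element `x` of `D^⊥`. -/
def isotropicSubalgebra {x : perp D} (hx : N (x : Oct F) = 0) :
    NonUnitalSubalgebra F (Oct F) where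
  __ := D.1.toSubmodule ⊔ leftMultiples D (x : Oct F)
  mul_mem' := by
    intro s t hs ht
    change s ∈ D.1.toSubmodule ⊔ leftMultiples D (x : Oct F) at hs
    change t ∈ D.1.toSubmodule ⊔ leftMultiples D (x : Oct F) at ht
    change s * t ∈ D.1.toSubmodule ⊔ leftMultiples D (x : Oct F)
    obtain ⟨a, ha, _, hs', rfl⟩ := Submodule.mem_sup.1 hs
    obtain ⟨b, hb, _, ht', rfl⟩ := Submodule.mem_sup.1 ht
    obtain ⟨c, rfl⟩ := mem_leftMultiples.1 hs'
    obtain ⟨d, rfl⟩ := mem_leftMultiples.1 ht'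
    lift a to D.1 using ha
    lift b to D.1 using hb
    refine Submodule.mem_sup.2 ⟨(a * b : D.1), (a * b).2, ((a * d + conjD b * c : D.1) : Oct F) * x,
      mem_leftMultiples.2 ⟨_, rfl⟩, ?_⟩
    have h1 : (c : Oct F) * (x : Oct F) * (b : Oct F) = (conjD b * c : D.1) * (x : Oct F) := by
      rw [← coe_smul_perp, perp_mul]
      exact (smul_assoc_of_mem D (conj_mem D b.2) c.2 x).symm
    have h2 : (a : Oct F) * ((d : Oct F) * (x : Oct F)) = (a * d : D.1) * (x : Oct F) :=
      (smul_assoc_of_mem D a.2 d.2 x).symm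
    rw [mul_add, add_mul, add_mul, hu.isotropic_mul_mul hx, h1, h2, add_zero]
    change _ + ((a * d : D.1) + (conjD b * c : D.1) : Oct F) * (x : Oct F) = _
    rw [add_mul, coe_mul a b]
    abel

theorem sup_mem_calXOver {L : Submodule F (Oct F)} (hL : L ∈ isotropicLines D) :
    D.1.toSubmodule ⊔ L ∈ calXOver D := by
  obtain ⟨x, hx, hx0, hN, rfl⟩ := hL
  lift x to perp D using hx
  have hmem : (x : Oct F) ∈ leftMultiples D (x : Oct F) :=
    mem_leftMultiples.2 ⟨1, SplitOctonion.one_mul _⟩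
  refine ⟨hu.isotropicSubalgebra hN, ⟨D, x, x.2, ?_, hx0, rfl⟩, ?_, rfl⟩
  · rw [perp_mul_self, hN, zero_smul, neg_zero]
  · refine lt_of_le_of_ne ?_ ?_
    · intro s hs
      exact (Submodule.mem_sup_left (show s ∈ D.1.toSubmodule from hs) :
        s ∈ D.1.toSubmodule ⊔ leftMultiples D (x : Oct F))
    · intro h
      refine hx0 (D.2.2.1 x ?_ hN)
      rw [h]
      exact (Submodule.mem_sup_right hmem :
        (x : Oct F) ∈ D.1.toSubmodule ⊔ leftMultiples D (x : Oct F))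

end IsGenerator

/-- Modular law: the line is recovered from `D + L`, which yields injectivity. -/
theorem sup_inf_perp {L : Submodule F (Oct F)} (hL : L ∈ isotropicLines D) :
    (D.1.toSubmodule ⊔ L) ⊓ perp D = L := by
  obtain ⟨x, hx, hx0, hN, rfl⟩ := hL
  rw [sup_comm, sup_inf_assoc_of_le _ (leftMultiples_le_perp ⟨x, hx⟩), disjoint_perp.eq_bot,
    sup_bot_eq]

theorem sup_injOn : Set.InjOn (fun L => D.1.toSubmodule ⊔ L) (isotropicLines D) := by
  intro L hL M hM h
  change D.1.toSubmodule ⊔ L = D.1.toSubmodule ⊔ M at h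
  rw [← sup_inf_perp hL, h, sup_inf_perp hM]

theorem finrank_leftMultiples_le (z : Oct F) : Module.finrank F (leftMultiples D z) ≤ 2 := by
  have hdim : Module.finrank F D.1.toSubmodule = 2 := D.2.1
  exact hdim ▸ Submodule.finrank_map_le _ _

theorem finrank_leftMultiples {x : perp D} (hx : x ≠ 0) :
    Module.finrank F (leftMultiples D (x : Oct F)) = 2 := by
  have hdim : Module.finrank F D.1.toSubmodule = 2 := D.2.1
  have h1 : leftMultiples D (x : Oct F) =
      LinearMap.range ((LinearMap.mulRight F (x : Oct F)).domRestrict D.1.toSubmodule) := by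
    rw [LinearMap.range_domRestrict]; rfl
  rw [h1, LinearMap.finrank_range_of_inj, hdim]
  rw [injective_iff_map_eq_zero]
  intro c hc
  have h2 : (⟨c.1, c.2⟩ : D.1) • x = 0 := Subtype.ext hc
  exact (smul_eq_zero.1 h2).resolve_right hx

theorem sup_surjOn : Set.SurjOn (fun L => D.1.toSubmodule ⊔ L) (isotropicLines D) (calXOver D) := by
  rintro _ ⟨X, ⟨E, z, hz, hzz, hz0, hX⟩, hDX, rfl⟩
  have hNz : N z = 0 := by
    have h := perp_mul_self (⟨z, hz⟩ : perp E)
    change z * z = -(N z • (1 : Oct F)) at h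
    rw [hzz, eq_comm, neg_eq_zero, smul_eq_zero] at h
    exact h.resolve_right one_ne_zero'
  have hzX : z ∈ X := by
    change z ∈ X.toSubmodule
    rw [hX]
    exact Submodule.mem_sup_right (mem_leftMultiples.2 ⟨1, SplitOctonion.one_mul _⟩)
  -- Elements of `D` have the form `e + cz` with `e`, `c` in `E`. Here `z` is orthogonal to `E`, and
  -- `(cz|z) = N(z)(c|1) = 0`.
  have hzD : z ∈ perp D := by
    intro d hd
    have hd' : d ∈ X.toSubmodule := hDX.le hd
    rw [hX] at hd'
    obtain ⟨e, he, s, hs, rfl⟩ := Submodule.mem_sup.1 hd'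
    obtain ⟨c, rfl⟩ := mem_leftMultiples.1 hs
    have := pol_mul_mul_right (c : Oct F) z 1
    rw [SplitOctonion.one_mul] at this
    rw [pol_add_left, hz e he, this, hNz, zero_mul, add_zero]
  refine ⟨leftMultiples D z, ⟨z, hzD, hz0, hNz, rfl⟩, ?_⟩
  change D.1.toSubmodule ⊔ leftMultiples D z = X.toSubmodule
  have hdim (D : calD F) : Module.finrank F D.1.toSubmodule = 2 := D.2.1
  refine Submodule.eq_of_le_of_finrank_le (sup_le hDX.le ?_) ?_
  · intro s hs
    obtain ⟨c, rfl⟩ := mem_leftMultiples.1 hs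
    exact X.mul_mem (hDX.le c.2) hzX
  -- The algebra `X = E + Ez` has dimension at most 4, while `D + Dz ⊆ X` already has dimension `2 +
  -- 2`.
  · have h1 : Module.finrank F X.toSubmodule ≤ 4 := by
      have := Submodule.finrank_add_le_finrank_add_finrank E.1.toSubmodule (leftMultiples E z)
      have h2 := finrank_leftMultiples_le (D := E) z
      rw [hX]
      have h3 := hdim E
      omega
    have h2 := Submodule.finrank_sup_add_finrank_inf_eq D.1.toSubmodule (leftMultiples D z)
    have h3 : Disjoint D.1.toSubmodule (leftMultiples D z) :=
      disjoint_perp.mono_right (leftMultiples_le_perp ⟨z, hzD⟩)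
    have h4 := finrank_leftMultiples (x := (⟨z, hzD⟩ : perp D))
      fun h => hz0 (congrArg Subtype.val h)
    change Module.finrank F (leftMultiples D z) = 2 at h4
    rw [h3.eq_bot, finrank_bot, hdim, h4] at h2
    omega

namespace IsGenerator

variable {u : D.1} (hu : IsGenerator u)
include hu

theorem sup_bijOn :
    Set.BijOn (fun L => D.1.toSubmodule ⊔ L) (isotropicLines D) (calXOver D) :=
  ⟨fun _ hL => hu.sup_mem_calXOver hL, sup_injOn, sup_surjOn⟩

theorem calXOver_doublyTransitive :
    ActsDoublyTransitively (stab (u : Oct F)) (calXOver D) := by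
  have hmap {α : Oct F ≃ₗ[F] Oct F} (hα : α ∈ stab (u : Oct F)) (L : Submodule F (Oct F)) :
      (D.1.toSubmodule ⊔ L).map (α : Oct F →ₗ[F] Oct F) =
        D.1.toSubmodule ⊔ L.map (α : Oct F →ₗ[F] Oct F) := by
    rw [Submodule.map_sup, hu.map_subfield hα]
  refine ⟨?_, ?_⟩
  · intro α hα V hV
    obtain ⟨L, hL, rfl⟩ := sup_surjOn hV
    change Submodule.map _ (D.1.toSubmodule ⊔ L) ∈ _
    rw [hmap hα]
    exact hu.sup_mem_calXOver (hu.isotropicLines_doublyTransitive.1 α hα L hL)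
  · intro V₁ hV₁ V₂ hV₂ W₁ hW₁ W₂ hW₂ hV hW
    obtain ⟨L₁, hL₁, rfl⟩ := sup_surjOn hV₁
    obtain ⟨L₂, hL₂, rfl⟩ := sup_surjOn hV₂
    obtain ⟨M₁, hM₁, rfl⟩ := sup_surjOn hW₁
    obtain ⟨M₂, hM₂, rfl⟩ := sup_surjOn hW₂
    obtain ⟨α, hα, h1, h2⟩ := hu.isotropicLines_doublyTransitive.2 L₁ hL₁ L₂ hL₂ M₁ hM₁ M₂ hM₂
      (fun h => hV (congrArg _ h)) (fun h => hW (congrArg _ h))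
    exact ⟨α, hα, (hmap hα L₁).trans (h1 ▸ rfl), (hmap hα L₂).trans (h2 ▸ rfl)⟩

end IsGenerator

end Geometry

/-! ### Finite ground fields and the matrix group -/

section FiniteField

variable {F : Type u} [Field F] {D : calD F}

variable (D) in
/-- `D ∈ 𝒟` as an algebra over the ground field. -/
noncomputable abbrev algebraSubfield : Algebra F D.1 where
  algebraMap := ofF D
  commutes' _ _ := mul_comm _ _
  smul_def' := smul_eq_ofF_mul

attribute [local instance] algebraSubfield

theorem natCard_subfield (D : calD F) : Nat.card D.1 = Nat.card F ^ 2 := by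
  have hdim : Module.finrank F D.1 = 2 := D.2.1
  rw [Module.natCard_eq_pow_finrank (K := F) (V := D.1), hdim]

instance [Finite F] : Finite D.1 := Module.finite_of_finite F

namespace IsGenerator

variable {u : D.1} (hu : IsGenerator u)
include hu

/-- Otherwise all `q²` elements of `D` would be roots of `T^q - T`. -/
theorem pow_card_ne [Finite F] : u ^ Nat.card F ≠ u := by
  intro h
  have := Fintype.ofFinite F
  have hq : 1 < Nat.card F := Finite.one_lt_card
  have hall (d : D.1) : d ^ Nat.card F = d := by
    obtain ⟨a, b, rfl⟩ := hu.exists_coords d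
    have h1 := map_add (FiniteField.frobeniusAlgHom F D.1) (ofF D a) (ofF D b * u)
    simp only [FiniteField.coe_frobeniusAlgHom, Fintype.card_eq_nat_card] at h1
    have hF (a : F) : a ^ Nat.card F = a := by
      rw [← Fintype.card_eq_nat_card, FiniteField.pow_card]
    rw [h1, mul_pow, h, ← map_pow, ← map_pow, hF, hF]
  have := Fintype.ofFinite D.1
  refine FiniteField.X_pow_card_sub_X_ne_zero D.1 hq
    (Polynomial.eq_zero_of_natDegree_lt_card_of_eval_eq_zero _ (f := fun d : D.1 => d)
      Function.injective_id (fun d => ?_) ?_)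
  · rw [Polynomial.eval_sub, Polynomial.eval_pow, Polynomial.eval_X, hall, sub_self]
  · rw [FiniteField.X_pow_card_sub_X_natDegree_eq _ hq, Fintype.card_eq_nat_card, natCard_subfield]
    nlinarith

/-- Over a finite field, the involution of `D` is the Frobenius map. -/
theorem conjD_eq_pow [Finite F] (d : D.1) : conjD d = d ^ Nat.card F := by
  have := Fintype.ofFinite F
  have hF (a : F) : a ^ Nat.card F = a := by
    rw [← Fintype.card_eq_nat_card, FiniteField.pow_card]
  have hadd (c d : D.1) : (c + d) ^ Nat.card F = c ^ Nat.card F + d ^ Nat.card F := by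
    have h1 := map_add (FiniteField.frobeniusAlgHom F D.1) c d
    simpa only [FiniteField.coe_frobeniusAlgHom, Fintype.card_eq_nat_card] using h1
  have hu1 : conjD u = u ^ Nat.card F := by
    have h2 := congrArg (· ^ Nat.card F) (show u * u + ofF D (N (u : Oct F)) = u by
      rw [hu.mul_self]; ring)
    simp only [hadd, mul_pow, ← map_pow, hF] at h2
    -- The power `u^q` is again a root of `T² - T + N(u) = (T - u)(T - ū)`.
    have h3 : (u ^ Nat.card F - u) * (u ^ Nat.card F - conjD u) = 0 := by
      have h4 := hu.mul_self
      rw [hu.conjD_eq]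
      linear_combination h2 - h4
    have := (mul_eq_zero.1 h3).resolve_left (sub_ne_zero.2 hu.pow_card_ne)
    exact (sub_eq_zero.1 this).symm
  obtain ⟨a, b, rfl⟩ := hu.exists_coords d
  rw [conjD_add, conjD_mul, conjD_ofF, conjD_ofF, hu1, hadd, mul_pow, ← map_pow, ← map_pow, hF, hF]

theorem exists_N_eq [Finite F] (a : F) : ∃ c : D.1, N (c : Oct F) = a := by
  obtain ⟨c, rfl⟩ := FiniteField.norm_surjective F D.1 a
  refine ⟨c, ofF_injective (D := D) ?_⟩
  have h := FiniteField.algebraMap_norm_eq_pow (K := F) (x := c)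
  have hq : 1 < Nat.card F := Finite.one_lt_card
  -- The field norm is `c ↦ c^((q²-1)/(q-1)) = c^(q+1) = c c̄`, which is `N(c)`.
  have h2 : (Nat.card D.1 - 1) / (Nat.card F - 1) = Nat.card F + 1 := by
    rw [natCard_subfield]
    refine Nat.div_eq_of_eq_mul_left (by omega) ?_
    have := Nat.sq_sub_sq (Nat.card F) 1
    rwa [one_pow] at this
  rw [h2, pow_succ, ← hu.conjD_eq_pow, mul_comm, mul_conjD] at h
  exact h.symm

theorem exists_orthonormal [Finite F] : ∃ e : Module.Basis (Fin 3) D.1 (perp D),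
    ∀ i j, gHat u (e i) (e j) = if i = j then 1 else 0 := by
  obtain ⟨x, hx⟩ := exists_perp_N_ne_zero D
  obtain ⟨y, hxy, hy⟩ := hu.exists_orthogonal_N_ne_zero hx
  obtain ⟨c, hc⟩ := hu.exists_N_eq (N (x : Oct F))⁻¹
  obtain ⟨d, hd⟩ := hu.exists_N_eq (N (y : Oct F))⁻¹
  have h1 : N ((c • x : perp D) : Oct F) = 1 := by
    rw [coe_smul_perp, N_mul, hc, inv_mul_cancel₀ hx]
  have h2 : N ((d • y : perp D) : Oct F) = 1 := by
    rw [coe_smul_perp, N_mul, hd, inv_mul_cancel₀ hy]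
  have h3 : gHat u (c • x) (d • y) = 0 := by
    rw [hu.gHat_smul_left, hu.gHat_smul_right, hxy, mul_zero, mul_zero]
  generalize c • x = x at h1 h3
  generalize d • y = y at h2 h3
  have h4 : N (hu.cross x y : Oct F) = 1 := by
    -- The Gram determinant of an orthonormal pair is 1, so the third vector needs no rescaling.
    rw [hu.N_cross, h1, h2, h3, ZeroMemClass.coe_zero, N_zero, mul_one, sub_zero]
  have hconj {x y : perp D} (h : gHat u x y = 0) : gHat u y x = 0 := by
    rw [← hu.gHat_conj, h, ← conjHom_apply, map_zero]
  have h5 := hu.gHat_left_cross x y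
  have h6 := hu.gHat_right_cross x y
  refine ⟨hu.crossBasis (h4 ▸ one_ne_zero), fun i j => ?_⟩
  rw [coe_crossBasis]
  fin_cases i <;> fin_cases j <;>
    simp [h3, hconj h3, h5, hconj h5, h6, hconj h6, hu.gHat_self, h1, h2, h4]

theorem gHat_orthonormal {e : Module.Basis (Fin 3) D.1 (perp D)}
    (he : ∀ i j, gHat u (e i) (e j) = if i = j then 1 else 0) (x y : perp D) :
    gHat u x y = ∑ i, e.repr x i * conjD (e.repr y i) := by
  conv_lhs => rw [← e.sum_repr x, ← e.sum_repr y]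
  simp only [Fin.sum_univ_three, gHat_add_left, hu.gHat_add_right, hu.gHat_smul_left,
    hu.gHat_smul_right, he]
  simp [mul_comm]

theorem gHat_map_of_basis (e : Module.Basis (Fin 3) D.1 (perp D)) (φ : perp D ≃ₗ[D.1] perp D)
    (h : ∀ i j, gHat u (φ (e i)) (φ (e j)) = gHat u (e i) (e j)) (x y : perp D) :
    gHat u (φ x) (φ y) = gHat u x y := by
  rw [← e.sum_repr x, ← e.sum_repr y]
  simp only [Fin.sum_univ_three, map_add, map_smul, gHat_add_left, hu.gHat_add_right,
    hu.gHat_smul_left, hu.gHat_smul_right, h]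

variable {K : Type v} [Field K] [StarRing K]

/-- The indices are swapped on the right because `ĝ` is linear in its first argument, whereas `A^*A`
conjugates its first factor. -/
theorem star_toMatrix_mul {e : Module.Basis (Fin 3) D.1 (perp D)}
    (he : ∀ i j, gHat u (e i) (e j) = if i = j then 1 else 0) (σ : D.1 ≃+* K)
    (hσ : ∀ d, σ (conjD d) = star (σ d)) (φ : perp D →ₗ[D.1] perp D) (i j : Fin 3) :
    (star ((LinearMap.toMatrix e e φ).map σ) * (LinearMap.toMatrix e e φ).map σ) i j =
      σ (gHat u (φ (e j)) (φ (e i))) := by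
  rw [hu.gHat_orthonormal he, map_sum, Matrix.mul_apply]
  refine Finset.sum_congr rfl fun k _ => ?_
  rw [Matrix.star_apply, Matrix.map_apply, Matrix.map_apply, LinearMap.toMatrix_apply,
    LinearMap.toMatrix_apply, map_mul, hσ, mul_comm]

/-- The matrix of a special unitary transformation with respect to an orthonormal basis. -/
noncomputable def toSpecialUnitaryGroup {e : Module.Basis (Fin 3) D.1 (perp D)}
    (he : ∀ i j, gHat u (e i) (e j) = if i = j then 1 else 0) (σ : D.1 ≃+* K)
    (hσ : ∀ d, σ (conjD d) = star (σ d)) : SU u →* Matrix.specialUnitaryGroup (Fin 3) K where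
  toFun φ := ⟨(LinearMap.toMatrix e e (φ.1 : perp D →ₗ[D.1] perp D)).map σ, by
    rw [Matrix.mem_specialUnitaryGroup_iff, Matrix.mem_unitaryGroup_iff']
    refine ⟨?_, ?_⟩
    · ext i j
      rw [hu.star_toMatrix_mul he σ hσ]
      change σ (gHat u (φ.1 (e j)) (φ.1 (e i))) = _
      rw [φ.2.1, he, Matrix.one_apply, apply_ite σ, map_one, map_zero]
      exact if_congr eq_comm rfl rfl
    · have h := congrArg Units.val φ.2.2
      rw [LinearEquiv.coe_det, Units.val_one, ← LinearMap.det_toMatrix e] at h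
      have := RingHom.map_det (σ : D.1 →+* K) (LinearMap.toMatrix e e (φ.1 : perp D →ₗ[D.1] perp D))
      rw [h, map_one] at this
      exact this.symm⟩
  map_one' := Subtype.ext <| by
    change (LinearMap.toMatrix e e LinearMap.id).map σ = 1
    rw [LinearMap.toMatrix_id, Matrix.map_one _ (map_zero σ) (map_one σ)]
  map_mul' φ ψ := Subtype.ext <| by
    change (LinearMap.toMatrix e e ((φ.1 : perp D →ₗ[D.1] perp D) ∘ₗ
      (ψ.1 : perp D →ₗ[D.1] perp D))).map σ = _ * _
    rw [LinearMap.toMatrix_comp e e e]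
    exact Matrix.map_mul (f := (σ : D.1 →+* K))

theorem nonempty_mulEquiv {e : Module.Basis (Fin 3) D.1 (perp D)}
    (he : ∀ i j, gHat u (e i) (e j) = if i = j then 1 else 0) (σ : D.1 ≃+* K)
    (hσ : ∀ d, σ (conjD d) = star (σ d)) :
    Nonempty (SU u ≃* Matrix.specialUnitaryGroup (Fin 3) K) := by
  refine ⟨MulEquiv.ofBijective (hu.toSpecialUnitaryGroup he σ hσ) ⟨?_, ?_⟩⟩
  · intro φ ψ h
    have h1 := Matrix.map_injective σ.injective (congrArg Subtype.val h)
    have h2 := (LinearMap.toMatrix e e).injective h1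
    exact Subtype.ext (LinearEquiv.toLinearMap_injective h2)
  · rintro ⟨A, hA⟩
    rw [Matrix.mem_specialUnitaryGroup_iff, Matrix.mem_unitaryGroup_iff'] at hA
    let f := Matrix.toLin e e (A.map σ.symm)
    have hf : LinearMap.toMatrix e e f = A.map σ.symm := LinearMap.toMatrix_toLin _ _ _
    have hfA : (LinearMap.toMatrix e e f).map σ = A := by
      rw [hf]; ext i j; simp
    have hdet : (LinearMap.toMatrix e e f).det = 1 := by
      apply σ.injective
      have := RingHom.map_det (σ : D.1 →+* K) (LinearMap.toMatrix e e f)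
      rw [map_one, ← hA.2]
      conv_rhs => rw [← hfA]
      exact this
    let φ := LinearEquiv.ofIsUnitDet (f := f) (v := e) (v' := e) (by rw [hdet]; exact isUnit_one)
    have hφf : (φ : perp D →ₗ[D.1] perp D) = f := LinearEquiv.coe_ofIsUnitDet _
    refine ⟨⟨φ, hu.gHat_map_of_basis e φ fun i j => ?_, ?_⟩, Subtype.ext ?_⟩
    · apply σ.injective
      have h1 := hu.star_toMatrix_mul he σ hσ f j i
      rw [hfA, hA.1, Matrix.one_apply] at h1
      rw [he, apply_ite σ, map_one, map_zero]
      exact h1.symm.trans (if_congr eq_comm rfl rfl)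
    · refine Units.ext ?_
      rw [LinearEquiv.coe_det, hφf, ← LinearMap.det_toMatrix e, hdet, Units.val_one]
    · change (LinearMap.toMatrix e e (φ : perp D →ₗ[D.1] perp D)).map σ = A
      rw [hφf, hfA]

theorem nonempty_mulEquiv_of_natCard [Finite F] (hK : Nat.card K = Nat.card F ^ 2)
    (hstar : ∀ x : K, star x = x ^ Nat.card F) :
    Nonempty (SU u ≃* Matrix.specialUnitaryGroup (Fin 3) K) := by
  have : Finite K := Nat.finite_of_card_ne_zero (by
    rw [hK]; exact pow_ne_zero _ Nat.card_pos.ne')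
  have := Fintype.ofFinite K
  have := Fintype.ofFinite D.1
  obtain ⟨e, he⟩ := hu.exists_orthonormal
  -- Any isomorphism will do: both involutions are the `q`-th power map, which ring homomorphisms
  -- respect.
  let σ : D.1 ≃+* K := FiniteField.ringEquivOfCardEq (by
    rw [Fintype.card_eq_nat_card, Fintype.card_eq_nat_card, natCard_subfield, hK])
  exact hu.nonempty_mulEquiv he σ fun d => by rw [hu.conjD_eq_pow, map_pow, hstar]

end IsGenerator

end FiniteField

end SplitOctonion

theorem mainTheorem7 {F : Type*} [Field F] (δ : F)
    (hδ : Irreducible (Polynomial.X ^ 2 - Polynomial.X - Polynomial.C δ : Polynomial F))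
    (D : SplitOctonion.calD F) (u : D.1) (hu : u ^ 2 - u - δ • (1 : D.1) = 0) :
    ∃ ρ : SplitOctonion.stab (u : SplitOctonion.Oct F) →* SplitOctonion.SU u,
      (∀ (α : SplitOctonion.stab (u : SplitOctonion.Oct F)) (x : SplitOctonion.perp D),
        ((ρ α).1 x : SplitOctonion.Oct F) = α.1 (x : SplitOctonion.Oct F)) ∧
      Function.Injective ρ ∧
      (Finite F →
        Function.Surjective ρ ∧
        (∀ (K : Type*) [Field K] [StarRing K], Nat.card K = Nat.card F ^ 2 →
          (∀ x : K, star x = x ^ Nat.card F) →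
          Nonempty (SplitOctonion.SU u ≃* Matrix.specialUnitaryGroup (Fin 3) K)) ∧
        SplitOctonion.ActsDoublyTransitively (SplitOctonion.stab (u : SplitOctonion.Oct F))
          (SplitOctonion.isotropicLines D) ∧
        Set.BijOn (fun L => D.1.toSubmodule ⊔ L)
          (SplitOctonion.isotropicLines D) (SplitOctonion.calXOver D) ∧
        SplitOctonion.ActsDoublyTransitively (SplitOctonion.stab (u : SplitOctonion.Oct F))
          (SplitOctonion.calXOver D)) := by
  have hu' := SplitOctonion.isGenerator_of_root hδ hu
  exact ⟨hu'.restrictHom, fun _ _ => rfl, hu'.restrictHom_injective, fun _ =>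
    ⟨hu'.restrictHom_surjective, fun K _ _ hK hstar => hu'.nonempty_mulEquiv_of_natCard hK hstar,
      hu'.isotropicLines_doublyTransitive, hu'.sup_bijOn, hu'.calXOver_doublyTransitive⟩⟩
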